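/- Let $\mathcal H\neq\{0\}$ be a complex Hilbert space and $\mathcal B$ the algebra of bounded operators on $\mathcal H$. Write $[A,B]=AB-BA$, $\{A,B\}=AB+BA$. Assume: * (H) $H$ is a (possibly unbounded) self-adjoint operator on $\mathcal H$ with domain $\mathscr D(H)$ and $\tau>0$ is such that $Z(\tau)=\operatorname{Tr}(e^{-H/\tau})<\infty$; put $\rho_\tau=e^{-H/\tau}/Z(\tau)$. * (W) $W_1,W_2,\dots\in\mathcal B$ are such that $\sum_j W_j^*W_j$ converges in the weak$^*$ topology of $\mathcal B$ (i.e. against all trace-class operators under the pairing $\operatorname{Tr}(A\rho)$). * (QDB) $G(A\rho_\tau)=G'(A)\rho_\tau$ for all $A\in\mathcal B$, where $$G(\rho)=\sum_j\big(W_j\rho W_j^*-\tfrac12\{W_j^*W_j,\rho\}\big),\qquad G'(A)=\sum_j\big(W_j^*AW_j-\tfrac12\{W_j^*W_j,A\}\big)$$ for trace-class $\rho$ and for $A\in\mathcal B$, respectively (the sums converging weakly). Let $\mathcal B_\tau$ be the Hilbert space completion of $\mathcal B$ with respect to the inner product $\langle A,B\rangle_\tau=\operatorname{Tr}(A^*B\rho_\tau)$.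 Let $L_0'(A)=i[H,A]$, defined for those $A\in\mathcal B$ with $A\mathscr D(H)\subseteq\mathscr D(H)$ for which $HA-AH$, defined on $\mathscr D(H)$, extends to a bounded operator on $\mathcal H$ (this extension being $[H,A]$); regard it as an operator in $\mathcal B_\tau$. Then: 1. $G'$ extends to a bounded operator on $\mathcal B_\tau$, and this operator is (a) self-adjoint, (b) nonpositive, and (c) has $0$ as an eigenvalue. 2. (d) $L_0'$ is densely defined and closable in $\mathcal B_\tau$, and its closure is anti-self-adjoint: $(\overline{L_0'})^*=-\overline{L_0'}$. 3. For all $A\in\mathcal B$, with a convergent series on the right, $$\langle A,G'(A)\rangle_\tau=-\frac12\sum_j\operatorname{Tr}\big([W_j,A]^*[W_j,A]\rho_\tau\big).$$ -/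

import Mathlib

open Filter Topology Set
open scoped ComplexOrder InnerProductSpace LinearPMap

namespace OpenQuantum

set_option linter.unusedSectionVars false

variable {ℋ : Type*} [NormedAddCommGroup ℋ] [InnerProductSpace ℂ ℋ] [CompleteSpace ℋ]

section Trace

variable (ℋ) in
/-- Index set of a fixed orthonormal (Hilbert) basis of `ℋ`. -/
noncomputable def BasisIndex : Set ℋ := (exists_hilbertBasis ℂ ℋ).choose

variable (ℋ) in
/-- A fixed orthonormal (Hilbert) basis of `ℋ`. -/
noncomputable def onb : HilbertBasis (BasisIndex ℋ) ℂ ℋ :=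
  (exists_hilbertBasis ℂ ℋ).choose_spec.choose

/-- The trace `Tr A = ∑ᵢ ⟨eᵢ, A eᵢ⟩` (meaningful, and independent of the basis, for trace-class
operators). -/
noncomputable def trace (A : ℋ →L[ℂ] ℋ) : ℂ := ∑' i, ⟪onb ℋ i, A (onb ℋ i)⟫_ℂ

/-- `A` is trace class: `Tr |A| = ∑ᵢ ⟨eᵢ, |A| eᵢ⟩ < ∞`, where `|A| = (A* A)^{1/2}`. -/
def IsTraceClass (A : ℋ →L[ℂ] ℋ) : Prop :=
  Summable fun i => ⟪onb ℋ i, CFC.abs A (onb ℋ i)⟫_ℂ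

variable (ℋ) in
/-- The positive trace-class operators. -/
structure PosTraceClass where
  /-- the underlying bounded operator -/
  op : ℋ →L[ℂ] ℋ
  nonneg : 0 ≤ op
  traceClass : IsTraceClass op

/-- Cyclicity of the trace for a product of two Hilbert-Schmidt operators. -/
theorem hs_swap {T U : ℋ →L[ℂ] ℋ} (hT : Summable fun i => ‖T (onb ℋ i)‖ ^ 2)
    (hU : Summable fun i => ‖U (onb ℋ i)‖ ^ 2) :
    (Summable fun i => ⟪T (onb ℋ i), U (onb ℋ i)⟫_ℂ) ∧
    (Summable fun k => ⟪(star U) (onb ℋ k), (star T) (onb ℋ k)⟫_ℂ) ∧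
    ∑' i, ⟪T (onb ℋ i), U (onb ℋ i)⟫_ℂ
      = ∑' k, ⟪(star U) (onb ℋ k), (star T) (onb ℋ k)⟫_ℂ := by
  have key : ∀ V : ℋ →L[ℂ] ℋ, (Summable fun i => ‖V (onb ℋ i)‖ ^ 2) →
      Summable fun p : BasisIndex ℋ × BasisIndex ℋ =>
        ‖⟪onb ℋ p.2, V (onb ℋ p.1)⟫_ℂ‖ ^ 2 := by
    intro V hV
    rw [summable_prod_of_nonneg (fun p => by positivity)]
    refine ⟨fun i => ?_, ?_⟩
    · simpa [HilbertBasis.repr_apply_apply] using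
        (lp.memℓp ((onb ℋ).repr (V (onb ℋ i)))).summable (by simp)
    · refine hV.congr fun i => ?_
      have h1 := lp.norm_rpow_eq_tsum (p := 2) (by simp) ((onb ℋ).repr (V (onb ℋ i)))
      simpa [HilbertBasis.repr_apply_apply] using h1
  have hsum : Summable fun p : BasisIndex ℋ × BasisIndex ℋ =>
      ⟪T (onb ℋ p.1), onb ℋ p.2⟫_ℂ * ⟪onb ℋ p.2, U (onb ℋ p.1)⟫_ℂ := by
    refine Summable.of_norm_bounded ((key T hT).add (key U hU)) fun p => ?_
    rw [norm_mul, norm_inner_symm]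
    nlinarith [sq_nonneg (‖⟪onb ℋ p.2, T (onb ℋ p.1)⟫_ℂ‖ - ‖⟪onb ℋ p.2, U (onb ℋ p.1)⟫_ℂ‖),
      sq_nonneg (‖⟪onb ℋ p.2, T (onb ℋ p.1)⟫_ℂ‖), sq_nonneg (‖⟪onb ℋ p.2, U (onb ℋ p.1)⟫_ℂ‖)]
  have h1 : ∀ i, ∑' k, ⟪T (onb ℋ i), onb ℋ k⟫_ℂ * ⟪onb ℋ k, U (onb ℋ i)⟫_ℂ
      = ⟪T (onb ℋ i), U (onb ℋ i)⟫_ℂ := fun i => (onb ℋ).tsum_inner_mul_inner _ _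
  have h2 : ∀ k, ∑' i, ⟪T (onb ℋ i), onb ℋ k⟫_ℂ * ⟪onb ℋ k, U (onb ℋ i)⟫_ℂ
      = ⟪(star U) (onb ℋ k), (star T) (onb ℋ k)⟫_ℂ := fun k => by
    rw [← (onb ℋ).tsum_inner_mul_inner]
    refine tsum_congr fun i => ?_
    rw [ContinuousLinearMap.star_eq_adjoint, ContinuousLinearMap.star_eq_adjoint,
      ContinuousLinearMap.adjoint_inner_left, ContinuousLinearMap.adjoint_inner_right, mul_comm]
  refine ⟨?_, ?_, ?_⟩
  · simpa only [h1] using hsum.prod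
  · simpa only [Prod.fst_swap, Prod.snd_swap, Prod.swap, h2] using hsum.prod_symm.prod
  · simp only [← h1, ← h2]
    exact hsum.tsum_comm.symm

theorem hs_star {T : ℋ →L[ℂ] ℋ} (hT : Summable fun i => ‖T (onb ℋ i)‖ ^ 2) :
    Summable fun i => ‖(star T) (onb ℋ i)‖ ^ 2 := by
  have h := (hs_swap hT hT).2.1.norm
  refine h.congr fun i => ?_
  rw [inner_self_eq_norm_sq_to_K]
  simp

theorem hs_comp (C : ℋ →L[ℂ] ℋ) {T : ℋ →L[ℂ] ℋ} (hT : Summable fun i => ‖T (onb ℋ i)‖ ^ 2) :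
    Summable fun i => ‖(C * T) (onb ℋ i)‖ ^ 2 := by
  refine Summable.of_nonneg_of_le (fun i => by positivity) (fun i => ?_) (hT.mul_left (‖C‖ ^ 2))
  rw [← mul_pow]
  exact pow_le_pow_left₀ (norm_nonneg _) (C.le_opNorm _) 2

namespace PosTraceClass

variable (ρ : PosTraceClass ℋ)

theorem sqrt_star : star (CFC.sqrt ρ.op) = CFC.sqrt ρ.op :=
  (CFC.sqrt_nonneg ρ.op).isSelfAdjoint

theorem hs_sqrt : Summable fun i => ‖(CFC.sqrt ρ.op) (onb ℋ i)‖ ^ 2 := by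
  have h := ρ.traceClass
  unfold IsTraceClass at h
  rw [CFC.abs_of_nonneg ρ.op ρ.nonneg] at h
  refine h.norm.congr fun i => ?_
  have h2 : ρ.op = star (CFC.sqrt ρ.op) * CFC.sqrt ρ.op := by
    rw [sqrt_star, CFC.sqrt_mul_sqrt_self ρ.op ρ.nonneg]
  conv_lhs => rw [h2]
  rw [mul_apply_eq_comp, ContinuousLinearMap.star_eq_adjoint,
    ContinuousLinearMap.adjoint_inner_right, inner_self_eq_norm_sq_to_K]
  simp

/-- `Tr(C ρ) = ∑ᵢ ⟨ρ^{1/2} eᵢ, C ρ^{1/2} eᵢ⟩`, both series being absolutely convergent. -/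
theorem trace_mul (C : ℋ →L[ℂ] ℋ) :
    (Summable fun i => ⟪onb ℋ i, (C * ρ.op) (onb ℋ i)⟫_ℂ) ∧
    (Summable fun i => ⟪(CFC.sqrt ρ.op) (onb ℋ i), (C * CFC.sqrt ρ.op) (onb ℋ i)⟫_ℂ) ∧
    trace (C * ρ.op)
      = ∑' i, ⟪(CFC.sqrt ρ.op) (onb ℋ i), (C * CFC.sqrt ρ.op) (onb ℋ i)⟫_ℂ := by
  have hT := hs_star (hs_comp C ρ.hs_sqrt)
  have h := hs_swap hT ρ.hs_sqrt
  have e : ∀ i, ⟪(star (C * CFC.sqrt ρ.op)) (onb ℋ i), (CFC.sqrt ρ.op) (onb ℋ i)⟫_ℂ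
      = ⟪onb ℋ i, (C * ρ.op) (onb ℋ i)⟫_ℂ := fun i => by
    rw [ContinuousLinearMap.star_eq_adjoint, ContinuousLinearMap.adjoint_inner_left,
      ← mul_apply_eq_comp, mul_assoc, CFC.sqrt_mul_sqrt_self ρ.op ρ.nonneg]
  simp only [e, star_star, sqrt_star] at h
  exact h

/-- The positive linear functional `A ↦ Tr(A ρ)` on the algebra of bounded operators. -/
noncomputable def functional : (ℋ →L[ℂ] ℋ) →ₚ[ℂ] ℂ :=
  PositiveLinearMap.mk₀
    { toFun := fun A => trace (A * ρ.op)
      map_add' := fun A B => by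
        rw [trace, trace, trace, ← (ρ.trace_mul A).1.tsum_add (ρ.trace_mul B).1]
        exact tsum_congr fun i => by simp [add_mul]
      map_smul' := fun c A => by
        rw [trace, trace, RingHom.id_apply, smul_eq_mul, ← tsum_mul_left]
        exact tsum_congr fun i => by simp }
    (fun A hA => by
      change 0 ≤ trace (A * ρ.op)
      rw [(ρ.trace_mul A).2.2]
      exact tsum_nonneg fun i =>
        ((ContinuousLinearMap.nonneg_iff_isPositive A).1 hA).inner_nonneg_right _)

theorem functional_apply (A : ℋ →L[ℂ] ℋ) : ρ.functional A = trace (A * ρ.op) := rfl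

/-- The Hilbert space completion of the algebra of bounded operators on `ℋ` with respect to the
inner product `⟨A, B⟩ = Tr(A* B ρ)`. -/
abbrev ObsSpace : Type _ := ρ.functional.GNS

/-- The canonical linear map from the bounded operators to the completion. -/
noncomputable def toObs : (ℋ →L[ℂ] ℋ) →ₗ[ℂ] ρ.ObsSpace :=
  (UniformSpace.Completion.toComplL (𝕜 := ℂ) (E := ρ.functional.PreGNS)).toLinearMap ∘ₗ
    ρ.functional.toPreGNS.toLinearMap

theorem inner_toObs (A B : ℋ →L[ℂ] ℋ) :
    ⟪ρ.toObs A, ρ.toObs B⟫_ℂ = trace (star A * B * ρ.op) :=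
  UniformSpace.Completion.inner_coe _ _

theorem denseRange_toObs : DenseRange ρ.toObs :=
  (UniformSpace.Completion.denseRange_coe (α := ρ.functional.PreGNS)).comp
    ρ.functional.toPreGNS.surjective.denseRange (UniformSpace.Completion.continuous_coe _)

theorem toObs_eq_zero {A : ℋ →L[ℂ] ℋ} (h : ρ.toObs A = 0) : A * ρ.op = 0 := by
  have h1 : trace (star A * A * ρ.op) = 0 := by rw [← inner_toObs, h, inner_zero_left]
  obtain ⟨-, hs, he⟩ := ρ.trace_mul (star A * A)
  have e : ∀ i, ⟪(CFC.sqrt ρ.op) (onb ℋ i), (star A * A * CFC.sqrt ρ.op) (onb ℋ i)⟫_ℂ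
      = ((‖(A * CFC.sqrt ρ.op) (onb ℋ i)‖ ^ 2 : ℝ) : ℂ) := fun i => by
    rw [mul_assoc, mul_apply_eq_comp (star A), ContinuousLinearMap.star_eq_adjoint,
      ContinuousLinearMap.adjoint_inner_right, ← mul_apply_eq_comp,
      inner_self_eq_norm_sq_to_K]
    simp
  rw [he] at h1
  simp only [e] at h1 hs
  rw [← Complex.ofReal_tsum, Complex.ofReal_eq_zero] at h1
  have h2 := (hasSum_zero_iff_of_nonneg (fun i => by positivity)).1
    (h1 ▸ (Complex.summable_ofReal.1 hs).hasSum)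
  have h3 : A * CFC.sqrt ρ.op = 0 := by
    refine ContinuousLinearMap.ext_on ?_ (s := Set.range (onb ℋ)) ?_
    · have := (onb ℋ).dense_span
      rw [← Submodule.dense_iff_topologicalClosure_eq_top] at this
      exact this
    · rintro _ ⟨i, rfl⟩
      have := congrFun h2 i
      simpa using this
  rw [← CFC.sqrt_mul_sqrt_self ρ.op ρ.nonneg, ← mul_assoc, h3, zero_mul]

end PosTraceClass

end Trace

section Gibbs

/-- `u : [0, s] → ℋ` solves `u' = -H u` in the open interval and is continuous up to its ends. -/
structure IsHeatCurve (H : ℋ →ₗ.[ℂ] ℋ) (s : ℝ) (u : ℝ → ℋ) : Prop where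
  continuousOn : ContinuousOn u (Icc 0 s)
  ode : ∀ t ∈ Ioo 0 s, ∃ h : u t ∈ H.domain, HasDerivAt u (-(H ⟨u t, h⟩)) t

/-- The bounded operator `R` is `e^{-sH}` (`s > 0`, `H` self-adjoint, not necessarily bounded below):
for every `x` there is a curve `u` with `u' = -H u`, `u 0 = x` and `u s = R x`. (For self-adjoint `H` this
determines `R`, since solutions are unique, and `R` is the operator `e^{-sH}` of the functional
calculus; see `IsExpNeg.eq`.) -/
def IsExpNeg (H : ℋ →ₗ.[ℂ] ℋ) (s : ℝ) (R : ℋ →L[ℂ] ℋ) : Prop :=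
  ∀ x, ∃ u : ℝ → ℋ, IsHeatCurve H s u ∧ u 0 = x ∧ u s = R x

open Classical in
/-- `e^{-sH}` as a bounded operator (`0` if it is not a bounded, everywhere defined operator). -/
noncomputable def expNeg (H : ℋ →ₗ.[ℂ] ℋ) (s : ℝ) : ℋ →L[ℂ] ℋ :=
  if h : ∃ R, IsExpNeg H s R then h.choose else 0

theorem expNeg_spec {H : ℋ →ₗ.[ℂ] ℋ} {s : ℝ} (h : ∃ R, IsExpNeg H s R) :
    IsExpNeg H s (expNeg H s) := by
  rw [expNeg, dif_pos h]
  exact h.choose_spec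

theorem IsHeatCurve.mono {H : ℋ →ₗ.[ℂ] ℋ} {s r : ℝ} {u : ℝ → ℋ} (hu : IsHeatCurve H s u)
    (hr : r ≤ s) : IsHeatCurve H r u :=
  ⟨hu.continuousOn.mono (Icc_subset_Icc_right hr), fun t ht => hu.ode t ⟨ht.1, ht.2.trans_le hr⟩⟩

theorem IsHeatCurve.inner_const {H : ℋ →ₗ.[ℂ] ℋ} (hH : IsSelfAdjoint H) {s : ℝ} {u w : ℝ → ℋ}
    (hu : IsHeatCurve H s u) (hw : IsHeatCurve H s w) {t : ℝ} (ht : t ∈ Icc 0 s) :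
    ⟪u t, w (s - t)⟫_ℂ = ⟪u s, w 0⟫_ℂ := by
  have hsymm : ∀ x y : H.domain, ⟪H x, (y : ℋ)⟫_ℂ = ⟪(x : ℋ), H y⟫_ℂ := by
    have h := H.adjoint_isFormalAdjoint hH.dense_domain
    rw [LinearPMap.isSelfAdjoint_def.1 hH] at h
    exact h
  have hc : ContinuousOn (fun t => ⟪u t, w (s - t)⟫_ℂ) (Icc 0 s) := by
    refine hu.continuousOn.inner (𝕜 := ℂ) (hw.continuousOn.comp (by fun_prop) fun t ht => ?_)
    exact ⟨by linarith [ht.2], by linarith [ht.1]⟩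
  have hd : ∀ t ∈ Ioo 0 s, HasDerivAt (fun t => ⟪u t, w (s - t)⟫_ℂ) 0 t := by
    intro t ht
    obtain ⟨h1, d1⟩ := hu.ode t ht
    obtain ⟨h2, d2⟩ := hw.ode (s - t) ⟨by linarith [ht.2], by linarith [ht.1]⟩
    have d3 : HasDerivAt (fun t => w (s - t)) (H ⟨w (s - t), h2⟩) t := by
      simpa [Function.comp_def] using d2.scomp t ((hasDerivAt_id t).const_sub s)
    have := d1.inner ℂ d3
    rwa [inner_neg_left, hsymm ⟨u t, h1⟩ ⟨w (s - t), h2⟩, add_neg_cancel] at this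
  have hpos : ∀ a ∈ Ioc 0 s, ⟪u a, w (s - a)⟫_ℂ = ⟪u s, w 0⟫_ℂ := by
    intro a ha
    have := constant_of_has_deriv_right_zero (hc.mono (Icc_subset_Icc_left ha.1.le))
      (fun x hx => (hd x ⟨ha.1.trans_le hx.1, hx.2⟩).hasDerivWithinAt) s ⟨ha.2, le_rfl⟩
    simpa using this.symm
  rcases ht.1.eq_or_lt with h0 | h0
  · subst h0
    rcases ht.2.eq_or_lt with h1 | h1
    · subst h1; simp
    · have hcl : (0 : ℝ) ∈ closure (Ioc 0 s) := by
        rw [closure_Ioc h1.ne]; exact ⟨le_rfl, h1.le⟩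
      have := Set.EqOn.of_subset_closure (f := fun t => ⟪u t, w (s - t)⟫_ℂ)
        (g := fun _ => ⟪u s, w 0⟫_ℂ) (s := Ioc 0 s) (t := Icc 0 s) hpos hc continuousOn_const
        Ioc_subset_Icc_self (by rw [closure_Ioc h1.ne])
      exact this ht
  · exact hpos t ⟨h0, ht.2⟩

theorem IsHeatCurve.inner_half {H : ℋ →ₗ.[ℂ] ℋ} (hH : IsSelfAdjoint H) {s : ℝ} (hs : 0 ≤ s)
    {u : ℝ → ℋ} (hu : IsHeatCurve H s u) : ⟪u s, u 0⟫_ℂ = ((‖u (s / 2)‖ ^ 2 : ℝ) : ℂ) := by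
  rw [← hu.inner_const hH hu (t := s / 2) ⟨by linarith, by linarith⟩]
  rw [show s - s / 2 = s / 2 by ring, inner_self_eq_norm_sq_to_K]
  simp

theorem IsExpNeg.eq {H : ℋ →ₗ.[ℂ] ℋ} (hH : IsSelfAdjoint H) {s : ℝ} (hs : 0 ≤ s)
    {R R' : ℋ →L[ℂ] ℋ} (hR : IsExpNeg H s R) (hR' : IsExpNeg H s R') : R = R' := by
  have key : ∀ {S T : ℋ →L[ℂ] ℋ}, IsExpNeg H s S → IsExpNeg H s T → ∀ x y,
      ⟪x, T y⟫_ℂ = ⟪S x, y⟫_ℂ := by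
    intro S T hS hT x y
    obtain ⟨u, hu, u0, u1⟩ := hS x
    obtain ⟨w, hw, w0, w1⟩ := hT y
    have := hu.inner_const hH hw (t := 0) ⟨le_rfl, hs⟩
    rwa [sub_zero, u0, u1, w0, w1] at this
  refine ContinuousLinearMap.ext fun y => ext_inner_left ℂ fun x => ?_
  rw [key hR hR, key hR hR']

theorem IsExpNeg.nonneg {H : ℋ →ₗ.[ℂ] ℋ} (hH : IsSelfAdjoint H) {s : ℝ} (hs : 0 ≤ s)
    {R : ℋ →L[ℂ] ℋ} (hR : IsExpNeg H s R) : 0 ≤ R := by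
  rw [ContinuousLinearMap.nonneg_iff_isPositive, ContinuousLinearMap.isPositive_iff_complex]
  intro x
  obtain ⟨u, hu, h0, h1⟩ := hR x
  rw [← h1, ← h0, hu.inner_half hH hs]
  refine ⟨by rw [RCLike.re_to_complex, Complex.ofReal_re], ?_⟩
  rw [RCLike.re_to_complex, Complex.ofReal_re]
  positivity

theorem IsExpNeg.injective {H : ℋ →ₗ.[ℂ] ℋ} (hH : IsSelfAdjoint H) {s : ℝ} (hs : 0 ≤ s)
    {R : ℋ →L[ℂ] ℋ} (hR : IsExpNeg H s R) {x : ℋ} (hx : R x = 0) : x = 0 := by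
  obtain ⟨u, hu, h0, h1⟩ := hR x
  have hz : ∀ n : ℕ, u (s / 2 ^ n) = 0 := by
    intro n
    induction n with
    | zero => simp [h1, hx]
    | succ n ih =>
      have hle : s / 2 ^ n ≤ s := div_le_self hs (one_le_pow₀ (by norm_num))
      have := (hu.mono hle).inner_half hH (by positivity)
      rw [ih, inner_zero_left] at this
      have h2 : ‖u (s / 2 ^ n / 2)‖ ^ 2 = 0 := by exact_mod_cast this.symm
      rw [pow_succ, ← div_div]
      simpa using h2
  have hlim : Tendsto (fun n : ℕ => s / 2 ^ n) atTop (𝓝[Icc 0 s] 0) := by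
    refine tendsto_nhdsWithin_iff.2 ⟨?_, Eventually.of_forall fun n =>
      ⟨by positivity, div_le_self hs (one_le_pow₀ (by norm_num))⟩⟩
    have := (tendsto_pow_atTop_nhds_zero_of_lt_one (r := (1 / 2 : ℝ)) (by norm_num)
      (by norm_num)).const_mul s
    simpa [div_eq_mul_inv] using this
  have h2 := (hu.continuousOn 0 ⟨le_rfl, hs⟩).tendsto.comp hlim
  rw [← h0]
  refine tendsto_nhds_unique h2 ?_
  simp [Function.comp_def, hz]

/-- Condition `(H)` at the temperature `τ`: `H` is self-adjoint and `Tr e^{-H/τ} < ∞`. -/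
structure ConditionH (H : ℋ →ₗ.[ℂ] ℋ) (τ : ℝ) : Prop where
  selfAdjoint : IsSelfAdjoint H
  temp_pos : 0 < τ
  exp_bounded : ∃ R, IsExpNeg H τ⁻¹ R
  traceClass : IsTraceClass (expNeg H τ⁻¹)

variable {H : ℋ →ₗ.[ℂ] ℋ} {τ : ℝ}

theorem ConditionH.exp_nonneg (h : ConditionH H τ) : 0 ≤ expNeg H τ⁻¹ :=
  (expNeg_spec h.exp_bounded).nonneg h.selfAdjoint (inv_nonneg.2 h.temp_pos.le)

/-- The partition function `Z(τ) = Tr e^{-H/τ}`. -/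
noncomputable def partitionFunction (H : ℋ →ₗ.[ℂ] ℋ) (τ : ℝ) : ℂ := trace (expNeg H τ⁻¹)

theorem ConditionH.partition_nonneg (h : ConditionH H τ) : 0 ≤ partitionFunction H τ :=
  tsum_nonneg fun _ =>
    ((ContinuousLinearMap.nonneg_iff_isPositive _).1 h.exp_nonneg).inner_nonneg_right _

theorem ConditionH.gibbs_nonneg (h : ConditionH H τ) :
    0 ≤ (partitionFunction H τ)⁻¹ • expNeg H τ⁻¹ := by
  rw [ContinuousLinearMap.nonneg_iff_isPositive]
  exact ((ContinuousLinearMap.nonneg_iff_isPositive _).1 h.exp_nonneg).smul_of_nonneg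
    (inv_nonneg.2 h.partition_nonneg)

/-- The Gibbs state `ρ_τ = e^{-H/τ} / Z(τ)`. -/
noncomputable def ConditionH.gibbs (h : ConditionH H τ) : PosTraceClass ℋ where
  op := (partitionFunction H τ)⁻¹ • expNeg H τ⁻¹
  nonneg := h.gibbs_nonneg
  traceClass := by
    have h1 := h.traceClass
    unfold IsTraceClass at h1 ⊢
    rw [CFC.abs_of_nonneg _ h.exp_nonneg] at h1
    rw [CFC.abs_of_nonneg _ h.gibbs_nonneg]
    simpa [inner_smul_right] using h1.mul_left (partitionFunction H τ)⁻¹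

theorem ConditionH.partition_ne_zero [Nontrivial ℋ] (h : ConditionH H τ) :
    partitionFunction H τ ≠ 0 := by
  intro hz
  let P : PosTraceClass ℋ := ⟨expNeg H τ⁻¹, h.exp_nonneg, h.traceClass⟩
  have h0 : P.toObs 1 = 0 := by
    rw [← inner_self_eq_zero (𝕜 := ℂ), P.inner_toObs]
    rw [star_one, one_mul, one_mul]
    exact hz
  have h1 : expNeg H τ⁻¹ = 0 := by simpa using P.toObs_eq_zero h0
  obtain ⟨x, hx⟩ := exists_ne (0 : ℋ)
  exact hx ((expNeg_spec h.exp_bounded).injective h.selfAdjoint (inv_nonneg.2 h.temp_pos.le)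
    (by rw [h1]; rfl))

/-- The canonical map from the bounded operators to the completion is injective at a Gibbs state. -/
theorem ConditionH.toObs_injective (h : ConditionH H τ) : Function.Injective h.gibbs.toObs := by
  rw [← LinearMap.ker_eq_bot, LinearMap.ker_eq_bot']
  intro A hA
  rcases subsingleton_or_nontrivial ℋ with hs | hs
  · exact Subsingleton.elim _ _
  have h1 : A * expNeg H τ⁻¹ = 0 := by
    have := h.gibbs.toObs_eq_zero hA
    change A * ((partitionFunction H τ)⁻¹ • expNeg H τ⁻¹) = 0 at this
    rw [mul_smul_comm, smul_eq_zero] at this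
    exact this.resolve_left (inv_ne_zero h.partition_ne_zero)
  have h2 : expNeg H τ⁻¹ * star A = 0 := by
    have := congrArg star h1
    rwa [star_mul, star_zero, h.exp_nonneg.isSelfAdjoint.star_eq] at this
  have h3 : star A = 0 := by
    ext x
    exact (expNeg_spec h.exp_bounded).injective h.selfAdjoint (inv_nonneg.2 h.temp_pos.le)
      (by rw [← mul_apply_eq_comp, h2]; rfl)
  simpa using h3

end Gibbs

section Lindblad

/-- The sum of a series of bounded operators in the weak operator topology. (Convergence in the
trace norm implies convergence in this topology, to the same sum.) -/
noncomputable def weakSum (f : ℕ → ℋ →L[ℂ] ℋ) : ℋ →L[ℂ] ℋ :=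
  (∑' j, (ContinuousLinearMapWOT.ofCLM (f j) : ℋ →WOT[ℂ] ℋ)).toCLM

/-- Condition `(W)`: the series `∑ⱼ Wⱼ* Wⱼ` converges in the weak-* topology, that is, against all
trace-class operators under the pairing `Tr(A ρ)`. -/
def ConditionW (W : ℕ → ℋ →L[ℂ] ℋ) : Prop :=
  ∃ Y : ℋ →L[ℂ] ℋ, ∀ ρ : ℋ →L[ℂ] ℋ, IsTraceClass ρ →
    Tendsto (fun N => trace ((∑ j ∈ Finset.range N, star (W j) * W j) * ρ)) atTop
      (𝓝 (trace (Y * ρ)))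

/-- The Lindblad operator `G(ρ) = ∑ⱼ (Wⱼ ρ Wⱼ* - ½ {Wⱼ* Wⱼ, ρ})` on trace-class operators. -/
noncomputable def lindblad (W : ℕ → ℋ →L[ℂ] ℋ) (ρ : ℋ →L[ℂ] ℋ) : ℋ →L[ℂ] ℋ :=
  weakSum fun j => W j * ρ * star (W j)
    - (1 / 2 : ℂ) • (star (W j) * W j * ρ + ρ * (star (W j) * W j))

/-- The dual Lindblad operator `G'(A) = ∑ⱼ (Wⱼ* A Wⱼ - ½ {Wⱼ* Wⱼ, A})` on bounded operators. -/
noncomputable def lindbladDual (W : ℕ → ℋ →L[ℂ] ℋ) (A : ℋ →L[ℂ] ℋ) : ℋ →L[ℂ] ℋ :=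
  weakSum fun j => star (W j) * A * W j
    - (1 / 2 : ℂ) • (star (W j) * W j * A + A * (star (W j) * W j))

/-- Quantum detailed balance with respect to `ρ`: `G(A ρ) = G'(A) ρ` for all bounded `A`. -/
def QDB (W : ℕ → ℋ →L[ℂ] ℋ) (ρ : PosTraceClass ℋ) : Prop :=
  ∀ A : ℋ →L[ℂ] ℋ, lindblad W (A * ρ.op) = lindbladDual W A * ρ.op

end Lindblad

section Heisenberg

/-- `A` maps the domain of `H` into itself and the bounded operator `C` extends the commutator
`H A - A H`. -/
def IsCommutator (H : ℋ →ₗ.[ℂ] ℋ) (A C : ℋ →L[ℂ] ℋ) : Prop :=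
  ∀ x : H.domain, ∃ h : A x ∈ H.domain, H ⟨A x, h⟩ - A (H x) = C x

theorem IsCommutator.unique {H : ℋ →ₗ.[ℂ] ℋ} (hd : Dense (H.domain : Set ℋ))
    {A C C' : ℋ →L[ℂ] ℋ} (h : IsCommutator H A C) (h' : IsCommutator H A C') : C = C' := by
  refine ContinuousLinearMap.ext fun x => ?_
  refine congrFun (Continuous.ext_on hd C.continuous C'.continuous fun y hy => ?_) x
  obtain ⟨_, h1⟩ := h ⟨y, hy⟩
  obtain ⟨_, h2⟩ := h' ⟨y, hy⟩
  exact h1.symm.trans h2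

/-- The graph `{(A, i[H, A])}` of the Heisenberg generator `L₀'`, as a subspace of `𝓑 × 𝓑`; its
domain consists of the bounded `A` that preserve the domain of `H` and have a bounded commutator
with `H`. -/
def heisenbergGraph (H : ℋ →ₗ.[ℂ] ℋ) : Submodule ℂ ((ℋ →L[ℂ] ℋ) × (ℋ →L[ℂ] ℋ)) where
  carrier := {p | ∃ C, IsCommutator H p.1 C ∧ p.2 = Complex.I • C}
  zero_mem' := ⟨0, fun x => ⟨by simp, by
    change H 0 - 0 = 0
    simp⟩, by simp⟩
  add_mem' := by
    rintro ⟨A, A'⟩ ⟨B, B'⟩ ⟨C, hC, hA⟩ ⟨D, hD, hB⟩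
    refine ⟨C + D, fun x => ?_, ?_⟩
    · obtain ⟨h1, e1⟩ := hC x
      obtain ⟨h2, e2⟩ := hD x
      refine ⟨H.domain.add_mem h1 h2, ?_⟩
      have : H ⟨(A + B) x, H.domain.add_mem h1 h2⟩ = H ⟨A x, h1⟩ + H ⟨B x, h2⟩ :=
        H.map_add ⟨A x, h1⟩ ⟨B x, h2⟩
      change H ⟨(A + B) x, _⟩ - (A (H x) + B (H x)) = C x + D x
      rw [this, ← e1, ← e2]
      abel
    · simp only [Prod.snd_add] at *
      rw [hA, hB, smul_add]
  smul_mem' := by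
    rintro c ⟨A, A'⟩ ⟨C, hC, hA⟩
    refine ⟨c • C, fun x => ?_, ?_⟩
    · obtain ⟨h1, e1⟩ := hC x
      refine ⟨H.domain.smul_mem c h1, ?_⟩
      have : H ⟨(c • A) x, H.domain.smul_mem c h1⟩ = c • H ⟨A x, h1⟩ := H.map_smul c ⟨A x, h1⟩
      change H ⟨(c • A) x, _⟩ - c • A (H x) = c • C x
      rw [this, ← e1, smul_sub]
    · simp only [Prod.smul_snd] at *
      rw [hA, smul_comm]

/-- The Heisenberg generator `L₀' A = i[H, A]` as an unbounded operator in the completion, with the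
image of the domain of `heisenbergGraph` as its domain; see `heisenbergGen_graph`. -/
noncomputable def heisenbergGen {H : ℋ →ₗ.[ℂ] ℋ} {τ : ℝ} (h : ConditionH H τ) :
    h.gibbs.ObsSpace →ₗ.[ℂ] h.gibbs.ObsSpace :=
  ((heisenbergGraph H).map (h.gibbs.toObs.prodMap h.gibbs.toObs)).toLinearPMap

/-- The graph of the Heisenberg generator is the image of `{(A, i[H, A])}`. -/
theorem heisenbergGen_graph {H : ℋ →ₗ.[ℂ] ℋ} {τ : ℝ} (h : ConditionH H τ) :
    (heisenbergGen h).graph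
      = (heisenbergGraph H).map (h.gibbs.toObs.prodMap h.gibbs.toObs) := by
  refine Submodule.toLinearPMap_graph_eq _ ?_
  rintro _ ⟨⟨A, A'⟩, ⟨C, hC, hA'⟩, rfl⟩ h0
  have hA : A = 0 := h.toObs_injective (by simpa using h0)
  subst hA
  have hC0 : C = 0 := by
    refine hC.unique h.selfAdjoint.dense_domain fun x => ⟨by simp, ?_⟩
    change H 0 - 0 = 0
    simp
  simp only at hA'
  simp [hA', hC0]

end Heisenberg

end OpenQuantum

/-!
The theorem has two independent halves.

*The Lindblad generator.* Testing condition `(W)` against rank-one states gives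
`∑ⱼ ‖Wⱼ x‖² ≤ K ‖x‖²` (`ConditionW.colBounded`). Hence `A ↦ ∑ⱼ Wⱼ* A Wⱼ` and `G'` are given by series that
converge weakly and are bounded in the operator norm. Splitting `ρ = ρ^{1/2} ρ^{1/2}` turns the trace
pairings into absolutely convergent Hilbert-Schmidt sums, so that `Tr(A* G(B ρ)) = Tr(G'(A)* B ρ)`
(`ColBounded.trace_star_mul_lindblad`). With detailed balance the left side is `⟨A, G'(B)⟩`, and `G'` is
symmetric for `⟨·, ·⟩_τ`. A map that is symmetric for an inner product and bounded in a stronger norm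
is bounded in the norm of the inner product (`norm_map_le_of_symmetric`), so `G'` extends to a bounded
self-adjoint operator. Taking the state of the carré du champ identity
`∑ⱼ [Wⱼ, A]* [Wⱼ, A] = G'(A* A) - A* G'(A) - G'(A*) A` and using `G'(1) = 0` gives the formula for
`⟨A, G'(A)⟩`, and with it the sign; the class of `1` is an eigenvector for the eigenvalue `0`.

*The Heisenberg generator.* The Gibbs state is compact, positive and injective, so it has an
orthonormal basis of eigenvectors. A heat curve that starts at an eigenvector of `e^{-H/τ}` is a scalar
multiple of it at all times, by log-convexity of `t ↦ ‖u t‖²` (`IsHeatCurve.eq_exp`), so these are also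
eigenvectors `f_k` of `H`, with real eigenvalues `ε_k`. The matrix units `|f_k⟩⟨f_l|`, normalized, form a
Hilbert basis of the completion, and `L₀'` multiplies the `(k, l)` coordinate by `i (ε_k - ε_l)`. An
operator that is diagonal in this sense has an anti-self-adjoint closure
(`closure_adjoint_eq_neg_of_diagonal`).
-/

namespace OpenQuantum

set_option linter.unusedSectionVars false

universe u

variable {ℋ : Type*} [NormedAddCommGroup ℋ] [InnerProductSpace ℂ ℋ] [CompleteSpace ℋ]

/-! ### Weakly convergent series of bounded operators -/

/-- The series `∑ⱼ fⱼ` of bounded operators converges unconditionally to `S` in the weak operator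
topology, expressed by matrix elements. -/
def WeakHasSum (f : ℕ → ℋ →L[ℂ] ℋ) (S : ℋ →L[ℂ] ℋ) : Prop :=
  ∀ x y, HasSum (fun j => ⟪x, f j y⟫_ℂ) ⟪x, S y⟫_ℂ

namespace WeakHasSum

variable {f g : ℕ → ℋ →L[ℂ] ℋ} {S T : ℋ →L[ℂ] ℋ}

theorem add (hf : WeakHasSum f S) (hg : WeakHasSum g T) :
    WeakHasSum (fun j => f j + g j) (S + T) := fun x y => by
  simpa only [add_apply, inner_add_right] using (hf x y).add (hg x y)

theorem sub (hf : WeakHasSum f S) (hg : WeakHasSum g T) :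
    WeakHasSum (fun j => f j - g j) (S - T) := fun x y => by
  simpa only [sub_apply, inner_sub_right] using (hf x y).sub (hg x y)

theorem smul (hf : WeakHasSum f S) (c : ℂ) : WeakHasSum (fun j => c • f j) (c • S) := fun x y => by
  simpa only [smul_apply, inner_smul_right] using (hf x y).mul_left c

theorem const_mul (hf : WeakHasSum f S) (C : ℋ →L[ℂ] ℋ) :
    WeakHasSum (fun j => C * f j) (C * S) := fun x y => by
  simpa only [mul_apply_eq_comp, ContinuousLinearMap.star_eq_adjoint,
    ContinuousLinearMap.adjoint_inner_left] using hf (star C x) y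

theorem mul_const (hf : WeakHasSum f S) (C : ℋ →L[ℂ] ℋ) :
    WeakHasSum (fun j => f j * C) (S * C) := fun x y => hf x (C y)

theorem star (hf : WeakHasSum f S) : WeakHasSum (fun j => star (f j)) (star S) := fun x y => by
  simpa only [ContinuousLinearMap.star_eq_adjoint, ContinuousLinearMap.adjoint_inner_right,
    RCLike.star_def, inner_conj_symm] using (hf y x).star

theorem unique (hf : WeakHasSum f S) (hg : WeakHasSum f T) : S = T :=
  ContinuousLinearMap.ext fun y => ext_inner_left ℂ fun x => (hf x y).unique (hg x y)

/-- Convergence of matrix elements is convergence in the weak operator topology, so `weakSum` has its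
intended value and not the default value of a divergent series. -/
theorem weakSum_eq (hf : WeakHasSum f S) : weakSum f = S := by
  have h : HasSum (fun j => (ContinuousLinearMapWOT.ofCLM (f j) : ℋ →WOT[ℂ] ℋ))
      (ContinuousLinearMapWOT.ofCLM S) := by
    refine ContinuousLinearMapWOT.tendsto_iff_forall_inner_apply_tendsto.2 fun x y => ?_
    refine (hf y x).congr fun F => ?_
    have : (∑ j ∈ F, (ContinuousLinearMapWOT.ofCLM (f j) : ℋ →WOT[ℂ] ℋ))
        = ContinuousLinearMapWOT.ofCLM (∑ j ∈ F, f j) :=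
      (map_sum (ContinuousLinearMapWOT.addEquiv (σ := RingHom.id ℂ) (E := ℋ) (F := ℋ)).symm
        f F).symm
    rw [this, ContinuousLinearMapWOT.ofCLM_apply, sum_apply, inner_sum]
  rw [weakSum, h.tsum_eq]

end WeakHasSum

/-- The column `x ↦ (Xⱼ x)ⱼ` is a bounded operator from `ℋ` into the square-summable sequences. The
constant bounds the square of its norm. -/
def ColBounded (X : ℕ → ℋ →L[ℂ] ℋ) : Prop :=
  ∃ K : ℝ, ∀ x, (Summable fun j => ‖X j x‖ ^ 2) ∧ ∑' j, ‖X j x‖ ^ 2 ≤ K * ‖x‖ ^ 2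

namespace ColBounded

variable {X Z : ℕ → ℋ →L[ℂ] ℋ}

theorem const_mul (hX : ColBounded X) (C : ℋ →L[ℂ] ℋ) : ColBounded fun j => C * X j := by
  obtain ⟨K, hK⟩ := hX
  have hle : ∀ x j, ‖(C * X j) x‖ ^ 2 ≤ ‖C‖ ^ 2 * ‖X j x‖ ^ 2 := fun x j => by
    rw [← mul_pow]
    exact pow_le_pow_left₀ (norm_nonneg _) (C.le_opNorm _) 2
  refine ⟨‖C‖ ^ 2 * K, fun x => ?_⟩
  have hs : Summable fun j => ‖(C * X j) x‖ ^ 2 :=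
    Summable.of_nonneg_of_le (fun j => by positivity) (hle x) ((hK x).1.mul_left _)
  refine ⟨hs, (hs.tsum_le_tsum (hle x) ((hK x).1.mul_left _)).trans ?_⟩
  rw [tsum_mul_left, mul_assoc]
  exact mul_le_mul_of_nonneg_left (hK x).2 (by positivity)

theorem mul_const (hX : ColBounded X) (C : ℋ →L[ℂ] ℋ) : ColBounded fun j => X j * C := by
  obtain ⟨K, hK⟩ := hX
  refine ⟨|K| * ‖C‖ ^ 2, fun x => ⟨(hK (C x)).1, (hK (C x)).2.trans ?_⟩⟩
  rw [mul_assoc, ← mul_pow]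
  exact mul_le_mul (le_abs_self K) (pow_le_pow_left₀ (norm_nonneg _) (C.le_opNorm _) 2)
    (by positivity) (abs_nonneg K)

theorem sub (hX : ColBounded X) (hZ : ColBounded Z) : ColBounded fun j => X j - Z j := by
  obtain ⟨K, hK⟩ := hX
  obtain ⟨L, hL⟩ := hZ
  have hle : ∀ x j, ‖(X j - Z j) x‖ ^ 2 ≤ 2 * ‖X j x‖ ^ 2 + 2 * ‖Z j x‖ ^ 2 := fun x j => by
    have h := pow_le_pow_left₀ (norm_nonneg _) (norm_sub_le (X j x) (Z j x)) 2
    rw [sub_apply]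
    nlinarith [sq_nonneg (‖X j x‖ - ‖Z j x‖)]
  refine ⟨2 * K + 2 * L, fun x => ?_⟩
  have hb := ((hK x).1.mul_left 2).add ((hL x).1.mul_left 2)
  have hs : Summable fun j => ‖(X j - Z j) x‖ ^ 2 :=
    Summable.of_nonneg_of_le (fun j => by positivity) (hle x) hb
  refine ⟨hs, (hs.tsum_le_tsum (hle x) hb).trans ?_⟩
  rw [((hK x).1.mul_left 2).tsum_add ((hL x).1.mul_left 2), tsum_mul_left, tsum_mul_left]
  linarith [(hK x).2, (hL x).2]

/-- A column-bounded sequence as a bounded operator into `ℓ²(ℕ, ℋ)`. -/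
theorem exists_column (hX : ColBounded X) :
    ∃ V : ℋ →L[ℂ] lp (fun _ : ℕ => ℋ) 2, ∀ x j, V x j = X j x := by
  obtain ⟨K, hK⟩ := hX
  have hmem : ∀ x, Memℓp (fun j => X j x) 2 := fun x =>
    memℓp_gen (by simpa using (hK x).1)
  let V : ℋ →ₗ[ℂ] lp (fun _ : ℕ => ℋ) 2 :=
    { toFun := fun x => ⟨fun j => X j x, hmem x⟩
      map_add' := fun x y => Subtype.ext (funext fun j => map_add (X j) x y)
      map_smul' := fun c x => Subtype.ext (funext fun j => map_smul (X j) c x) }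
  refine ⟨V.mkContinuous (√|K|) fun x => ?_, fun x j => rfl⟩
  refine abs_le_of_sq_le_sq' ?_ (by positivity) |>.2
  have h1 := lp.norm_rpow_eq_tsum (p := 2) (by simp) (V x)
  have h2 : ‖V x‖ ^ 2 = ∑' j, ‖X j x‖ ^ 2 := by simpa [V] using h1
  rw [h2, mul_pow, Real.sq_sqrt (abs_nonneg K)]
  exact (hK x).2.trans (mul_le_mul_of_nonneg_right (le_abs_self K) (by positivity))

/-- The sum is `V* U`, where `V` and `U` are the columns of `X` and `Z`. -/
theorem exists_weakHasSum (hX : ColBounded X) (hZ : ColBounded Z) :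
    ∃ S, WeakHasSum (fun j => star (X j) * Z j) S := by
  obtain ⟨V, hV⟩ := hX.exists_column
  obtain ⟨U, hU⟩ := hZ.exists_column
  refine ⟨V.adjoint ∘L U, fun x y => ?_⟩
  rw [ContinuousLinearMap.comp_apply, ContinuousLinearMap.adjoint_inner_right]
  refine (lp.hasSum_inner (V x) (U y)).congr_fun fun j => ?_
  rw [hV, hU, mul_apply_eq_comp, ContinuousLinearMap.star_eq_adjoint,
    ContinuousLinearMap.adjoint_inner_right]

end ColBounded

/-- `A ↦ ∑ⱼ Wⱼ* A Wⱼ` is bounded in the operator norm. -/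
theorem exists_norm_weakSum_conj_le {W : ℕ → ℋ →L[ℂ] ℋ} (hW : ColBounded W) :
    ∃ K : ℝ, ∀ A S : ℋ →L[ℂ] ℋ, WeakHasSum (fun j => star (W j) * A * W j) S →
      ‖S‖ ≤ K * ‖A‖ := by
  obtain ⟨V, hV⟩ := hW.exists_column
  refine ⟨‖V‖ * ‖V‖, fun A S hS => ?_⟩
  obtain ⟨U, hU⟩ := (hW.const_mul A).exists_column
  have hS' : S = V.adjoint ∘L U := by
    refine ContinuousLinearMap.ext fun y => ext_inner_left ℂ fun x => (hS x y).unique ?_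
    rw [ContinuousLinearMap.comp_apply, ContinuousLinearMap.adjoint_inner_right]
    refine (lp.hasSum_inner (V x) (U y)).congr_fun fun j => ?_
    change ⟪x, (star (W j) * A * W j) y⟫_ℂ = _
    rw [hV, hU, mul_assoc, mul_apply_eq_comp (star (W j)), ContinuousLinearMap.star_eq_adjoint,
      ContinuousLinearMap.adjoint_inner_right]
  have hUV : ‖U‖ ≤ ‖A‖ * ‖V‖ := by
    refine U.opNorm_le_bound (by positivity) fun x => ?_
    refine le_trans ?_ (mul_le_mul_of_nonneg_left (V.le_opNorm x) (norm_nonneg A)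
      |>.trans_eq (mul_assoc _ _ _).symm)
    have hn : ∀ v : lp (fun _ : ℕ => ℋ) 2, HasSum (fun j => ‖v j‖ ^ 2) (‖v‖ ^ 2) := fun v => by
      simpa using lp.hasSum_norm (p := 2) (by simp) v
    refine abs_le_of_sq_le_sq' ?_ (by positivity) |>.2
    rw [mul_pow]
    refine hasSum_le (fun j => ?_) (hn (U x)) ((hn (V x)).mul_left (‖A‖ ^ 2))
    rw [hU, hV, ← mul_pow]
    exact pow_le_pow_left₀ (norm_nonneg _) (A.le_opNorm _) 2
  rw [hS']
  refine (ContinuousLinearMap.opNorm_comp_le _ _).trans ?_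
  rw [LinearIsometryEquiv.norm_map]
  calc ‖V‖ * ‖U‖ ≤ ‖V‖ * (‖A‖ * ‖V‖) := by gcongr
    _ = _ := by ring

theorem isTraceClass_rankOne (x : ℋ) : IsTraceClass (InnerProductSpace.rankOne ℂ x x) := by
  have h : 0 ≤ InnerProductSpace.rankOne ℂ x x :=
    (ContinuousLinearMap.nonneg_iff_isPositive _).2 (InnerProductSpace.isPositive_rankOne_self x)
  rw [IsTraceClass, CFC.abs_of_nonneg _ h]
  refine ((onb ℋ).summable_inner_mul_inner x x).congr fun i => ?_
  rw [InnerProductSpace.rankOne_apply, inner_smul_right]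

theorem trace_mul_rankOne (C : ℋ →L[ℂ] ℋ) (x y : ℋ) :
    trace (C * InnerProductSpace.rankOne ℂ x y) = ⟪y, C x⟫_ℂ := by
  rw [trace, ← (onb ℋ).tsum_inner_mul_inner]
  refine tsum_congr fun i => ?_
  rw [mul_apply_eq_comp, InnerProductSpace.rankOne_apply, map_smul, inner_smul_right]

/-- Testing condition `(W)` against the rank-one states bounds the column `(Wⱼ)ⱼ`. -/
theorem ConditionW.colBounded {W : ℕ → ℋ →L[ℂ] ℋ} (hW : ConditionW W) : ColBounded W := by
  obtain ⟨Y, hY⟩ := hW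
  refine ⟨‖Y‖, fun x => ?_⟩
  have h := hY _ (isTraceClass_rankOne x)
  simp only [trace_mul_rankOne] at h
  have e : ∀ N, (⟪x, (∑ j ∈ Finset.range N, star (W j) * W j) x⟫_ℂ).re
      = ∑ j ∈ Finset.range N, ‖W j x‖ ^ 2 := fun N => by
    rw [sum_apply, inner_sum, Complex.re_sum]
    refine Finset.sum_congr rfl fun j _ => ?_
    rw [mul_apply_eq_comp, ContinuousLinearMap.star_eq_adjoint,
      ContinuousLinearMap.adjoint_inner_right, inner_self_eq_norm_sq_to_K]
    norm_cast
  have h2 := (Complex.continuous_re.tendsto _).comp h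
  simp only [Function.comp_def, e] at h2
  have h3 := (hasSum_iff_tendsto_nat_of_nonneg (fun j => by positivity) _).2 h2
  refine ⟨h3.summable, h3.tsum_eq.trans_le ?_⟩
  calc (⟪x, Y x⟫_ℂ).re ≤ ‖⟪x, Y x⟫_ℂ‖ := Complex.re_le_norm _
    _ ≤ ‖x‖ * ‖Y x‖ := norm_inner_le_norm _ _
    _ ≤ ‖x‖ * (‖Y‖ * ‖x‖) := by gcongr; exact Y.le_opNorm x
    _ = _ := by ring

/-! ### Traces of weakly convergent series of products of Hilbert-Schmidt operators -/

theorem hasSum_norm_sq_inner {ι E : Type*} [NormedAddCommGroup E] [InnerProductSpace ℂ E]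
    (b : HilbertBasis ι ℂ E) (x : E) : HasSum (fun i => ‖⟪b i, x⟫_ℂ‖ ^ 2) (‖x‖ ^ 2) := by
  simpa [HilbertBasis.repr_apply_apply] using lp.hasSum_norm (p := 2) (by simp) (b.repr x)

/-- The series defining the trace of `A` converges absolutely, with sum `t`. -/
def HasTrace (A : ℋ →L[ℂ] ℋ) (t : ℂ) : Prop :=
  HasSum (fun i => ⟪onb ℋ i, A (onb ℋ i)⟫_ℂ) t

namespace HasTrace

variable {A B : ℋ →L[ℂ] ℋ} {a b : ℂ}

theorem trace_eq (hA : HasTrace A a) : trace A = a := hA.tsum_eq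

theorem add (hA : HasTrace A a) (hB : HasTrace B b) : HasTrace (A + B) (a + b) := by
  simpa only [HasTrace, add_apply, inner_add_right] using HasSum.add hA hB

theorem sub (hA : HasTrace A a) (hB : HasTrace B b) : HasTrace (A - B) (a - b) := by
  simpa only [HasTrace, sub_apply, inner_sub_right] using HasSum.sub hA hB

theorem smul (hA : HasTrace A a) (c : ℂ) : HasTrace (c • A) (c * a) := by
  simpa only [HasTrace, smul_apply, inner_smul_right] using HasSum.mul_left c hA

end HasTrace

/-- `T` is a Hilbert-Schmidt operator: `∑ᵢ ‖T eᵢ‖² < ∞`. -/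
def IsHilbertSchmidt (T : ℋ →L[ℂ] ℋ) : Prop := Summable fun i => ‖T (onb ℋ i)‖ ^ 2

theorem IsHilbertSchmidt.hasTrace {T U : ℋ →L[ℂ] ℋ} (hT : IsHilbertSchmidt T)
    (hU : IsHilbertSchmidt U) : HasTrace (star T * U) (trace (star T * U)) := by
  refine Summable.hasSum ((hs_swap hT hU).1.congr fun i => ?_)
  rw [mul_apply_eq_comp, ContinuousLinearMap.star_eq_adjoint,
    ContinuousLinearMap.adjoint_inner_right]

theorem IsHilbertSchmidt.trace_comm {T U : ℋ →L[ℂ] ℋ} (hT : IsHilbertSchmidt T)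
    (hU : IsHilbertSchmidt U) : trace (star T * U) = trace (U * star T) := by
  have h := (hs_swap hT hU).2.2
  simp only [trace, mul_apply_eq_comp]
  refine Eq.trans (tsum_congr fun i => ?_) (h.trans (tsum_congr fun i => ?_))
  · rw [ContinuousLinearMap.star_eq_adjoint, ContinuousLinearMap.adjoint_inner_right]
  · rw [ContinuousLinearMap.star_eq_adjoint U, ContinuousLinearMap.adjoint_inner_left]

theorem IsHilbertSchmidt.tsum_norm_sq_star {T : ℋ →L[ℂ] ℋ} (hT : IsHilbertSchmidt T) :
    ∑' i, ‖T (onb ℋ i)‖ ^ 2 = ∑' i, ‖(star T) (onb ℋ i)‖ ^ 2 := by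
  have e : ∀ v : ℋ, ⟪v, v⟫_ℂ = ((‖v‖ ^ 2 : ℝ) : ℂ) := fun v => by
    rw [inner_self_eq_norm_sq_to_K]; norm_cast
  have h := (hs_swap hT hT).2.2
  simp only [e] at h
  rw [← Complex.ofReal_tsum, ← Complex.ofReal_tsum] at h
  exact Complex.ofReal_injective h

/-- The sequence `X` satisfies `∑ⱼ ‖Xⱼ‖₂² < ∞`, where `‖·‖₂` is the Hilbert-Schmidt norm. -/
def HSSummable (X : ℕ → ℋ →L[ℂ] ℋ) : Prop :=
  Summable fun p : ℕ × BasisIndex ℋ => ‖X p.1 (onb ℋ p.2)‖ ^ 2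

namespace HSSummable

variable {X Z : ℕ → ℋ →L[ℂ] ℋ}

theorem isHilbertSchmidt (hX : HSSummable X) (j : ℕ) : IsHilbertSchmidt (X j) :=
  (summable_prod_of_nonneg (fun p => by positivity)).1 hX |>.1 j

theorem star (hX : HSSummable X) : HSSummable fun j => star (X j) := by
  have h := (summable_prod_of_nonneg
    (f := fun p : ℕ × BasisIndex ℋ => ‖X p.1 (onb ℋ p.2)‖ ^ 2) fun p => sq_nonneg _).1 hX
  have h1 : ∀ j, IsHilbertSchmidt (X j) := h.1
  have h1' : ∀ j, IsHilbertSchmidt (Star.star (X j)) := fun j => hs_star (h1 j)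
  refine (summable_prod_of_nonneg
    (f := fun p : ℕ × BasisIndex ℋ => ‖(Star.star (X p.1)) (onb ℋ p.2)‖ ^ 2)
    fun p => sq_nonneg _).2 ⟨h1', ?_⟩
  have e : ∀ j, ∑' i, ‖X j (onb ℋ i)‖ ^ 2 = ∑' i, ‖(Star.star (X j)) (onb ℋ i)‖ ^ 2 := fun j =>
    (h1 j).tsum_norm_sq_star
  have h2 := h.2
  simp only [e] at h2
  exact h2

theorem const_mul (hX : HSSummable X) (C : ℋ →L[ℂ] ℋ) : HSSummable fun j => C * X j := by
  refine Summable.of_nonneg_of_le (fun p => by positivity) (fun p => ?_) (hX.mul_left (‖C‖ ^ 2))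
  rw [← mul_pow]
  exact pow_le_pow_left₀ (norm_nonneg _) (C.le_opNorm _) 2

theorem colBounded (hX : HSSummable X) : ColBounded X := by
  have hle : ∀ x (p : ℕ × BasisIndex ℋ), ‖⟪onb ℋ p.2, X p.1 x⟫_ℂ‖ ^ 2
      ≤ ‖(Star.star (X p.1)) (onb ℋ p.2)‖ ^ 2 * ‖x‖ ^ 2 := fun x p => by
    rw [← mul_pow, ← ContinuousLinearMap.adjoint_inner_left]
    exact pow_le_pow_left₀ (norm_nonneg _) (norm_inner_le_norm _ _) 2
  have hn : ∀ x j, HasSum (fun i => ‖⟪onb ℋ i, X j x⟫_ℂ‖ ^ 2) (‖X j x‖ ^ 2) := fun x j =>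
    hasSum_norm_sq_inner (onb ℋ) (X j x)
  refine ⟨∑' p : ℕ × BasisIndex ℋ, ‖(Star.star (X p.1)) (onb ℋ p.2)‖ ^ 2, fun x => ?_⟩
  have hb := hX.star.mul_right (‖x‖ ^ 2)
  have hs := Summable.of_nonneg_of_le (fun p => by positivity) (hle x) hb
  have h := hs.hasSum.prod_fiberwise (hn x)
  refine ⟨h.summable, ?_⟩
  rw [h.tsum_eq, ← tsum_mul_right]
  exact hs.tsum_le_tsum (hle x) hb

/-- The trace is countably additive along weakly convergent series of products of two
square-summable sequences of Hilbert-Schmidt operators. -/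
theorem hasSum_trace (hX : HSSummable X) (hZ : HSSummable Z) {S : ℋ →L[ℂ] ℋ}
    (hS : WeakHasSum (fun j => Star.star (X j) * Z j) S) :
    HasTrace S (trace S) ∧ HasSum (fun j => trace (Star.star (X j) * Z j)) (trace S) := by
  have e : ∀ j x y, ⟪x, (Star.star (X j) * Z j) y⟫_ℂ = ⟪X j x, Z j y⟫_ℂ := fun j x y => by
    rw [mul_apply_eq_comp, ContinuousLinearMap.star_eq_adjoint,
      ContinuousLinearMap.adjoint_inner_right]
  have hs : Summable fun p : ℕ × BasisIndex ℋ =>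
      ⟪X p.1 (onb ℋ p.2), Z p.1 (onb ℋ p.2)⟫_ℂ := by
    refine Summable.of_norm_bounded (hX.add hZ) fun p => ?_
    refine (norm_inner_le_norm _ _).trans ?_
    nlinarith [sq_nonneg (‖X p.1 (onb ℋ p.2)‖ - ‖Z p.1 (onb ℋ p.2)‖),
      sq_nonneg ‖X p.1 (onb ℋ p.2)‖, sq_nonneg ‖Z p.1 (onb ℋ p.2)‖]
  have h1 : HasTrace S (∑' p : ℕ × BasisIndex ℋ, ⟪X p.1 (onb ℋ p.2), Z p.1 (onb ℋ p.2)⟫_ℂ) := by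
    refine HasSum.prod_fiberwise ((Equiv.prodComm _ _).hasSum_iff.2 hs.hasSum) fun i => ?_
    exact (hS (onb ℋ i) (onb ℋ i)).congr_fun fun j => (e j _ _).symm
  rw [h1.trace_eq]
  refine ⟨h1, hs.hasSum.prod_fiberwise fun j => ?_⟩
  simpa only [HasTrace, e] using (hX.isHilbertSchmidt j).hasTrace (hZ.isHilbertSchmidt j)

end HSSummable

theorem ColBounded.hsSummable {X : ℕ → ℋ →L[ℂ] ℋ} (hX : ColBounded X) {T : ℋ →L[ℂ] ℋ}
    (hT : IsHilbertSchmidt T) : HSSummable fun j => X j * T := by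
  obtain ⟨K, hK⟩ := hX
  have h : Summable fun p : BasisIndex ℋ × ℕ => ‖X p.2 (T (onb ℋ p.1))‖ ^ 2 := by
    refine (summable_prod_of_nonneg (fun p => by positivity)).2 ⟨fun i => (hK (T (onb ℋ i))).1, ?_⟩
    exact Summable.of_nonneg_of_le (fun i => tsum_nonneg fun j => by positivity)
      (fun i => (hK (T (onb ℋ i))).2) (hT.mul_left K)
  exact (Equiv.prodComm _ _).summable_iff.2 h

namespace PosTraceClass

variable (ρ : PosTraceClass ℋ)

theorem isHilbertSchmidt_sqrt : IsHilbertSchmidt (CFC.sqrt ρ.op) := ρ.hs_sqrt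

theorem trace_mul_eq_trace_sqrt (C : ℋ →L[ℂ] ℋ) :
    trace (C * ρ.op) = trace (CFC.sqrt ρ.op * C * CFC.sqrt ρ.op) := by
  rw [(ρ.trace_mul C).2.2, trace]
  refine tsum_congr fun i => ?_
  conv_lhs => rw [← ContinuousLinearMap.adjoint_inner_right, ← ContinuousLinearMap.star_eq_adjoint,
    ρ.sqrt_star]
  rw [mul_assoc, mul_apply_eq_comp (CFC.sqrt ρ.op)]

/-- The state `A ↦ Tr(A ρ)` is countably additive along weakly convergent series `∑ⱼ Xⱼ* Zⱼ` with
bounded columns. -/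
theorem hasSum_trace_mul {X Z : ℕ → ℋ →L[ℂ] ℋ} (hX : ColBounded X) (hZ : ColBounded Z)
    {S : ℋ →L[ℂ] ℋ} (hS : WeakHasSum (fun j => star (X j) * Z j) S) :
    HasSum (fun j => trace (star (X j) * Z j * ρ.op)) (trace (S * ρ.op)) := by
  have h := HSSummable.hasSum_trace (hX.hsSummable ρ.isHilbertSchmidt_sqrt)
    (hZ.hsSummable ρ.isHilbertSchmidt_sqrt) (S := CFC.sqrt ρ.op * S * CFC.sqrt ρ.op) (by
      simpa only [star_mul, ρ.sqrt_star, mul_assoc] using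
        (hS.const_mul (CFC.sqrt ρ.op)).mul_const (CFC.sqrt ρ.op))
  rw [trace_mul_eq_trace_sqrt]
  refine h.2.congr_fun fun j => ?_
  rw [trace_mul_eq_trace_sqrt]
  simp only [star_mul, ρ.sqrt_star, mul_assoc]

theorem hasTrace_mul (C : ℋ →L[ℂ] ℋ) : HasTrace (C * ρ.op) (trace (C * ρ.op)) :=
  (ρ.trace_mul C).1.hasSum

/-- `Tr(A ρ B) = Tr(B A ρ)`. -/
theorem hasTrace_mul_mul (A B : ℋ →L[ℂ] ℋ) :
    HasTrace (A * ρ.op * B) (trace (B * A * ρ.op)) := by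
  have h1 : IsHilbertSchmidt (star (A * CFC.sqrt ρ.op)) := hs_star (hs_comp A ρ.hs_sqrt)
  have h2 : IsHilbertSchmidt (CFC.sqrt ρ.op * B) := by
    have := hs_star (hs_comp (star B) ρ.hs_sqrt)
    rwa [star_mul, star_star, ρ.sqrt_star] at this
  have h := h1.hasTrace h2
  rw [h1.trace_comm h2, star_star] at h
  rw [trace_mul_eq_trace_sqrt]
  have e : A * CFC.sqrt ρ.op * (CFC.sqrt ρ.op * B) = A * ρ.op * B := by
    rw [mul_assoc, ← mul_assoc (CFC.sqrt ρ.op), CFC.sqrt_mul_sqrt_self ρ.op ρ.nonneg, mul_assoc]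
  rw [e] at h
  simpa only [mul_assoc] using h

end PosTraceClass

/-! ### The Lindblad operators -/

section LindbladOperators

variable {W : ℕ → ℋ →L[ℂ] ℋ}

theorem ColBounded.exists_weakHasSum_conj (hW : ColBounded W) (A : ℋ →L[ℂ] ℋ) :
    ∃ S, WeakHasSum (fun j => star (W j) * A * W j) S := by
  simpa only [mul_assoc] using hW.exists_weakHasSum (hW.const_mul A)

theorem lindbladDual_eq_of_weakHasSum {Y S A : ℋ →L[ℂ] ℋ}
    (hY : WeakHasSum (fun j => star (W j) * W j) Y)
    (hS : WeakHasSum (fun j => star (W j) * A * W j) S) :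
    lindbladDual W A = S - (1 / 2 : ℂ) • (Y * A + A * Y) :=
  (hS.sub (((hY.mul_const A).add (hY.const_mul A)).smul _)).weakSum_eq

theorem lindblad_eq_of_weakHasSum {Y S ρ : ℋ →L[ℂ] ℋ}
    (hY : WeakHasSum (fun j => star (W j) * W j) Y)
    (hS : WeakHasSum (fun j => W j * ρ * star (W j)) S) :
    lindblad W ρ = S - (1 / 2 : ℂ) • (Y * ρ + ρ * Y) :=
  (hS.sub (((hY.mul_const ρ).add (hY.const_mul ρ)).smul _)).weakSum_eq

theorem ColBounded.weakHasSum_lindbladDual (hW : ColBounded W) (A : ℋ →L[ℂ] ℋ) :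
    WeakHasSum (fun j => star (W j) * A * W j
      - (1 / 2 : ℂ) • (star (W j) * W j * A + A * (star (W j) * W j))) (lindbladDual W A) := by
  obtain ⟨Y, hY⟩ := hW.exists_weakHasSum hW
  obtain ⟨S, hS⟩ := hW.exists_weakHasSum_conj A
  rw [lindbladDual_eq_of_weakHasSum hY hS]
  exact hS.sub (((hY.mul_const A).add (hY.const_mul A)).smul _)

theorem ColBounded.lindbladDual_star (hW : ColBounded W) (A : ℋ →L[ℂ] ℋ) :
    lindbladDual W (star A) = star (lindbladDual W A) := by
  refine (hW.weakHasSum_lindbladDual (star A)).unique ?_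
  have h := (hW.weakHasSum_lindbladDual A).star
  simp only [star_sub, star_smul, star_add, star_mul, star_star] at h
  have e : star (1 / 2 : ℂ) = 1 / 2 := by simp
  simpa only [e, mul_assoc, add_comm] using h

theorem lindbladDual_one : lindbladDual W 1 = 0 := by
  have h : WeakHasSum (fun j => star (W j) * 1 * W j
      - (1 / 2 : ℂ) • (star (W j) * W j * 1 + 1 * (star (W j) * W j))) 0 := fun x y => by
    convert! hasSum_zero using 2 with j
    · beta_reduce
      rw [mul_one, mul_one, one_mul, ← two_smul ℂ, smul_smul]
      norm_num
    · simp
  exact h.weakSum_eq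

theorem ColBounded.exists_norm_lindbladDual_le (hW : ColBounded W) :
    ∃ K : ℝ, ∀ A, ‖lindbladDual W A‖ ≤ K * ‖A‖ := by
  obtain ⟨Y, hY⟩ := hW.exists_weakHasSum hW
  obtain ⟨K, hK⟩ := exists_norm_weakSum_conj_le hW
  refine ⟨K + ‖Y‖, fun A => ?_⟩
  obtain ⟨S, hS⟩ := hW.exists_weakHasSum_conj A
  rw [lindbladDual_eq_of_weakHasSum hY hS]
  have h1 : ‖(1 / 2 : ℂ) • (Y * A + A * Y)‖ ≤ ‖Y‖ * ‖A‖ := by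
    rw [norm_smul]
    have := (norm_add_le (Y * A) (A * Y)).trans (add_le_add (norm_mul_le _ _) (norm_mul_le _ _))
    norm_num
    linarith
  calc _ ≤ ‖S‖ + ‖(1 / 2 : ℂ) • (Y * A + A * Y)‖ := norm_sub_le _ _
    _ ≤ K * ‖A‖ + ‖Y‖ * ‖A‖ := add_le_add (hK A S hS) h1
    _ = _ := by ring

/-- `G'` as a linear map on the bounded operators. -/
noncomputable def ColBounded.lindbladDualₗ (hW : ColBounded W) :
    (ℋ →L[ℂ] ℋ) →ₗ[ℂ] ℋ →L[ℂ] ℋ where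
  toFun := lindbladDual W
  map_add' A B := by
    refine (hW.weakHasSum_lindbladDual (A + B)).unique ?_
    convert! (hW.weakHasSum_lindbladDual A).add (hW.weakHasSum_lindbladDual B) using 2 with j
    rw [mul_add, mul_add, add_mul, add_mul, sub_add_sub_comm, ← smul_add, add_add_add_comm]
  map_smul' c A := by
    refine (hW.weakHasSum_lindbladDual (c • A)).unique ?_
    convert! (hW.weakHasSum_lindbladDual A).smul c using 2 with j
    rw [mul_smul_comm, smul_mul_assoc, mul_smul_comm, smul_mul_assoc, ← smul_add,
      smul_sub, smul_comm c]

/-- The duality between `G` and `G'`: `Tr(A* G(B ρ)) = Tr(G'(A)* B ρ)`. The square root of `ρ` is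
split off so that all series are absolutely convergent sums of Hilbert-Schmidt pairings. -/
theorem ColBounded.trace_star_mul_lindblad (hW : ColBounded W) (ρ : PosTraceClass ℋ)
    (A B : ℋ →L[ℂ] ℋ) :
    trace (star A * lindblad W (B * ρ.op)) = trace (star (lindbladDual W A) * B * ρ.op) := by
  set T := CFC.sqrt ρ.op with hTdef
  have hTT : T * T = ρ.op := CFC.sqrt_mul_sqrt_self ρ.op ρ.nonneg
  have hTs : star T = T := ρ.sqrt_star
  have hT : IsHilbertSchmidt T := ρ.isHilbertSchmidt_sqrt
  obtain ⟨Y, hY⟩ := hW.exists_weakHasSum hW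
  obtain ⟨Φ, hΦ⟩ := hW.exists_weakHasSum_conj (star A)
  have h1 : HSSummable fun j => W j * T := hW.hsSummable hT
  -- `A* W_j B ρ W_j* = (T B* W_j* A)* (T W_j*)`, and both families are square-summable because their
  -- adjoints `A* W_j B T` and `W_j T` are.
  have h2 : HSSummable fun j => W j * B * T := (hW.mul_const B).hsSummable hT
  have h3 : HSSummable fun j => star A * (W j * B * T) := h2.const_mul (star A)
  obtain ⟨S, hS⟩ := h2.star.colBounded.exists_weakHasSum h1.star.colBounded
  have hS1 : WeakHasSum (fun j => W j * (B * ρ.op) * star (W j)) S := by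
    simpa only [star_star, star_mul, hTs, mul_assoc, ← hTT] using hS
  have hS2 : WeakHasSum (fun j => star (star (star A * (W j * B * T))) * star (W j * T))
      (star A * S) := by
    simpa only [star_star, mul_assoc] using hS.const_mul (star A)
  have hΦ2 : WeakHasSum (fun j => star (W j * T) * (star A * (W j * B * T))) (T * Φ * B * T) := by
    simpa only [star_mul, hTs, mul_assoc] using ((hΦ.const_mul T).mul_const B).mul_const T
  have e1 : trace (star A * S) = trace (Φ * B * ρ.op) := by
    rw [ρ.trace_mul_eq_trace_sqrt, ← hTdef, ← mul_assoc]
    refine (h3.star.hasSum_trace h1.star hS2).2.unique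
      (HasSum.congr_fun (h1.hasSum_trace h3 hΦ2).2 fun j => ?_)
    rw [(h3.star.isHilbertSchmidt j).trace_comm (h1.star.isHilbertSchmidt j), star_star]
  have hL : HasTrace (star A * lindblad W (B * ρ.op)) (trace (Φ * B * ρ.op)
      - (1 / 2 : ℂ) * (trace (star A * Y * B * ρ.op) + trace (Y * (star A * B) * ρ.op))) := by
    have := (h3.star.hasSum_trace h1.star hS2).1
    rw [e1] at this
    have h := this.sub (((ρ.hasTrace_mul (star A * Y * B)).add
      (ρ.hasTrace_mul_mul (star A * B) Y)).smul (1 / 2))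
    convert! h using 1
    rw [lindblad_eq_of_weakHasSum hY hS1, mul_sub, mul_smul_comm, mul_add]
    simp only [mul_assoc]
  have hR : HasTrace (star (lindbladDual W A) * B * ρ.op) (trace (Φ * B * ρ.op)
      - (1 / 2 : ℂ) * (trace (star A * Y * B * ρ.op) + trace (Y * (star A * B) * ρ.op))) := by
    have h := (ρ.hasTrace_mul (Φ * B)).sub (((ρ.hasTrace_mul (star A * Y * B)).add
      (ρ.hasTrace_mul (Y * (star A * B)))).smul (1 / 2))
    convert! h using 1
    rw [← hW.lindbladDual_star, lindbladDual_eq_of_weakHasSum hY hΦ, sub_mul, sub_mul, smul_mul_assoc,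
      smul_mul_assoc, add_mul, add_mul, add_comm]
    simp only [mul_assoc]
  rw [hL.trace_eq, hR.trace_eq]

end LindbladOperators

/-! ### Boundedness of symmetric maps -/

/-- A linear map that is bounded in one norm and symmetric for an inner product dominated by that
norm is bounded in the norm of the inner product: the numbers `aₙ = ‖e (gⁿ A)‖` are log-convex, so
`a₁ > C a₀` would make them grow faster than `Cⁿ`. -/
theorem norm_map_le_of_symmetric {E K : Type*} [NormedAddCommGroup E] [NormedSpace ℂ E]
    [NormedAddCommGroup K] [InnerProductSpace ℂ K] (e : E →ₗ[ℂ] K) (g : E →ₗ[ℂ] E) {c C : ℝ}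
    (hC : 0 < C) (he : ∀ A, ‖e A‖ ≤ c * ‖A‖) (hg : ∀ A, ‖g A‖ ≤ C * ‖A‖)
    (hsymm : ∀ A B, ⟪e A, e (g B)⟫_ℂ = ⟪e (g A), e B⟫_ℂ) (A : E) : ‖e (g A)‖ ≤ C * ‖e A‖ := by
  by_contra! hlt
  set a : ℕ → ℝ := fun n => ‖e ((g ^ n) A)‖ with ha
  have hsucc : ∀ n, (g ^ (n + 1)) A = g ((g ^ n) A) := fun n => by
    rw [pow_succ', Module.End.mul_apply]
  have ha1 : C * a 0 < a 1 := by simpa [ha] using hlt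
  have hlog : ∀ n, a (n + 1) ^ 2 ≤ a n * a (n + 2) := fun n => by
    have h := hsymm ((g ^ n) A) (g ((g ^ n) A))
    rw [inner_self_eq_norm_sq_to_K] at h
    have h2 : a (n + 1) ^ 2 = ‖⟪e ((g ^ n) A), e (g (g ((g ^ n) A)))⟫_ℂ‖ := by
      rw [h, norm_pow, RCLike.norm_ofReal, abs_norm, ha]
      simp only [hsucc]
    rw [h2]
    refine (norm_inner_le_norm _ _).trans_eq ?_
    simp only [ha, hsucc]
  have ha0 : 0 < a 0 := by
    rcases (norm_nonneg (e ((g ^ 0) A))).eq_or_lt with h0 | h0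
    · have h1 := hlog 0
      have h00 : a 0 = 0 := h0.symm
      rw [h00] at h1 ha1
      nlinarith
    · exact h0
  set r := a 1 / a 0 with hr
  have hrC : C < r := (lt_div_iff₀ ha0).2 ha1
  have hr0 : 0 < r := hC.trans hrC
  have hgrow : ∀ n, 0 < a n ∧ r * a n ≤ a (n + 1) := fun n => by
    induction n with
    | zero => exact ⟨ha0, by rw [hr, div_mul_cancel₀ _ ha0.ne']⟩
    | succ n ih =>
      have hpos : 0 < a (n + 1) := (mul_pos hr0 ih.1).trans_le ih.2
      refine ⟨hpos, ?_⟩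
      have h1 := hlog n
      have h2 : r * a n * a (n + 1) ≤ a n * a (n + 2) :=
        (mul_le_mul_of_nonneg_right ih.2 hpos.le).trans (by rw [← sq]; exact h1)
      nlinarith [ih.1]
  have hlow : ∀ n, r ^ n * a 0 ≤ a n := fun n => by
    induction n with
    | zero => simp
    | succ n ih =>
      calc r ^ (n + 1) * a 0 = r * (r ^ n * a 0) := by ring
        _ ≤ r * a n := mul_le_mul_of_nonneg_left ih hr0.le
        _ ≤ _ := (hgrow n).2
  have hup : ∀ n, a n ≤ |c| * (C ^ n * ‖A‖) := fun n => by
    have h1 : ‖(g ^ n) A‖ ≤ C ^ n * ‖A‖ := by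
      induction n with
      | zero => simp
      | succ n ih =>
        rw [hsucc]
        calc _ ≤ C * ‖(g ^ n) A‖ := hg _
          _ ≤ C * (C ^ n * ‖A‖) := mul_le_mul_of_nonneg_left ih hC.le
          _ = _ := by ring
    exact (he _).trans (mul_le_mul (le_abs_self c) h1 (norm_nonneg _) (abs_nonneg c))
  have hlim : Tendsto (fun n : ℕ => |c| * ‖A‖ * (C / r) ^ n) atTop (𝓝 (|c| * ‖A‖ * 0)) :=
    (tendsto_pow_atTop_nhds_zero_of_lt_one (by positivity) ((div_lt_one hr0).2 hrC)).const_mul _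
  rw [mul_zero] at hlim
  refine ha0.not_ge (ge_of_tendsto hlim (Eventually.of_forall fun n => ?_))
  rw [div_pow, ← mul_div_assoc, le_div_iff₀ (pow_pos hr0 n)]
  have := (hlow n).trans (hup n)
  linarith

/-- A linear map `g` that, with respect to the images under a map `e` of dense range, is bounded,
symmetric and nonpositive extends to a bounded, self-adjoint and nonpositive operator. -/
theorem exists_extension_of_symmetric {E K : Type*} [AddCommGroup E] [Module ℂ E]
    [NormedAddCommGroup K] [InnerProductSpace ℂ K] [CompleteSpace K] (e : E →ₗ[ℂ] K)
    (g : E →ₗ[ℂ] E) (hd : DenseRange e) {C : ℝ} (hC : ∀ A, ‖e (g A)‖ ≤ C * ‖e A‖)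
    (hsymm : ∀ A B, ⟪e A, e (g B)⟫_ℂ = ⟪e (g A), e B⟫_ℂ)
    (hneg : ∀ A, (⟪e A, e (g A)⟫_ℂ).re ≤ 0) :
    ∃ G : K →L[ℂ] K, (∀ A, G (e A) = e (g A)) ∧ IsSelfAdjoint G ∧ G ≤ 0 := by
  have hG : ∀ A, (e ∘ₗ g).extendOfNorm e (e A) = e (g A) := fun A =>
    LinearMap.extendOfNorm_eq hd ⟨C, hC⟩ A
  set G : K →L[ℂ] K := (e ∘ₗ g).extendOfNorm e
  have hs : ∀ x y, ⟪G x, y⟫_ℂ = ⟪x, G y⟫_ℂ := fun x y => by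
    refine hd.induction_on₂ (p := fun x y => ⟪G x, y⟫_ℂ = ⟪x, G y⟫_ℂ) ?_ (fun A B => ?_) x y
    · exact isClosed_eq (by fun_prop) (by fun_prop)
    · rw [hG, hG, hsymm]
  have hsa : IsSelfAdjoint G := (ContinuousLinearMap.isSelfAdjoint_iff_isSymmetric).2 hs
  refine ⟨G, hG, hsa, ?_⟩
  rw [ContinuousLinearMap.le_def, zero_sub, ContinuousLinearMap.isPositive_def']
  refine ⟨hsa.neg, fun x => ?_⟩
  refine hd.induction_on x ?_ fun A => ?_
  · simp only [ContinuousLinearMap.reApplyInnerSelf_apply]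
    exact isClosed_le (by fun_prop) (by fun_prop)
  · rw [ContinuousLinearMap.reApplyInnerSelf_apply, neg_apply, inner_neg_left,
      hG, map_neg, ← hsymm]
    exact neg_nonneg.2 (hneg A)

/-! ### The Lindblad generator on the completion -/

namespace PosTraceClass

variable (ρ : PosTraceClass ℋ)

theorem hasSum_norm_sq_toObs (A : ℋ →L[ℂ] ℋ) :
    HasSum (fun i => ‖(A * CFC.sqrt ρ.op) (onb ℋ i)‖ ^ 2) (‖ρ.toObs A‖ ^ 2) := by
  have h := (ρ.trace_mul (star A * A)).2
  have hs := h.1.hasSum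
  rw [← h.2, ← ρ.inner_toObs, inner_self_eq_norm_sq_to_K] at hs
  have h2 := Complex.hasSum_re hs
  convert! h2 using 1
  · ext i
    rw [mul_assoc, mul_apply_eq_comp (star A), ContinuousLinearMap.star_eq_adjoint,
      ContinuousLinearMap.adjoint_inner_right, ← mul_apply_eq_comp, inner_self_eq_norm_sq_to_K]
    norm_cast
  · norm_cast

theorem exists_norm_toObs_le : ∃ c : ℝ, ∀ A, ‖ρ.toObs A‖ ≤ c * ‖A‖ := by
  refine ⟨‖ρ.toObs 1‖, fun A => ?_⟩
  refine abs_le_of_sq_le_sq' ?_ (by positivity) |>.2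
  rw [mul_pow, mul_comm]
  refine hasSum_le (fun i => ?_) (ρ.hasSum_norm_sq_toObs A)
    ((ρ.hasSum_norm_sq_toObs 1).mul_left (‖A‖ ^ 2))
  rw [← mul_pow, one_mul]
  exact pow_le_pow_left₀ (norm_nonneg _) (A.le_opNorm _) 2

end PosTraceClass

section DetailedBalance

variable {W : ℕ → ℋ →L[ℂ] ℋ} {ρ : PosTraceClass ℋ}

theorem QDB.symmetric (h : QDB W ρ) (hW : ColBounded W) (A B : ℋ →L[ℂ] ℋ) :
    ⟪ρ.toObs A, ρ.toObs (lindbladDual W B)⟫_ℂ = ⟪ρ.toObs (lindbladDual W A), ρ.toObs B⟫_ℂ := by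
  rw [ρ.inner_toObs, ρ.inner_toObs, ← hW.trace_star_mul_lindblad, h B, mul_assoc]

/-- The carré du champ identity
`∑ⱼ [Wⱼ, A]* [Wⱼ, A] = G'(A* A) - A* G'(A) - G'(A*) A`. -/
theorem ColBounded.weakHasSum_commutator (hW : ColBounded W) (A : ℋ →L[ℂ] ℋ) :
    WeakHasSum (fun j => star (W j * A - A * W j) * (W j * A - A * W j))
      (lindbladDual W (star A * A) - star A * lindbladDual W A - lindbladDual W (star A) * A) := by
  have h := ((hW.weakHasSum_lindbladDual (star A * A)).sub
    ((hW.weakHasSum_lindbladDual A).const_mul (star A))).sub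
    ((hW.weakHasSum_lindbladDual (star A)).mul_const A)
  convert! h using 2 with j
  have h2 : star (W j * A - A * W j) * (W j * A - A * W j)
      = star A * star (W j) * W j * A - star A * star (W j) * A * W j
        - star (W j) * star A * W j * A + star (W j) * star A * A * W j := by
    rw [star_sub, star_mul, star_mul]
    noncomm_ring
  -- `A* Wⱼ* Wⱼ A` collects one half from each of `A* G'(A)` and `G'(A*) A`.
  have h3 : star A * star (W j) * W j * A
      = (1 / 2 : ℂ) • (star A * star (W j) * W j * A)
        + (1 / 2 : ℂ) • (star A * star (W j) * W j * A) := by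
    rw [← add_smul]
    norm_num
  rw [h2, h3]
  simp only [mul_sub, sub_mul, mul_smul_comm, smul_mul_assoc, mul_add, add_mul, smul_add, mul_assoc]
  abel

/-- The state of the carré du champ identity: `Tr(G'(A* A) ρ) = ⟨G'(1), A* A⟩ = 0`, and the two other
terms both equal `-⟨A, G'(A)⟩` by symmetry. -/
theorem QDB.hasSum_commutator (h : QDB W ρ) (hW : ColBounded W) (A : ℋ →L[ℂ] ℋ) :
    HasSum (fun j => -(1 / 2 : ℂ) *
        trace (star (W j * A - A * W j) * (W j * A - A * W j) * ρ.op))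
      ⟪ρ.toObs A, ρ.toObs (lindbladDual W A)⟫_ℂ := by
  have hC : ColBounded fun j => W j * A - A * W j := (hW.mul_const A).sub (hW.const_mul A)
  have hs := (ρ.hasSum_trace_mul hC hC (hW.weakHasSum_commutator A)).mul_left (-(1 / 2 : ℂ))
  have h1 : trace (lindbladDual W (star A * A) * ρ.op) = 0 := by
    have := h.symmetric hW 1 (star A * A)
    rwa [lindbladDual_one, map_zero, inner_zero_left, ρ.inner_toObs, star_one, one_mul] at this
  have h2 : trace (lindbladDual W (star A) * A * ρ.op)
      = ⟪ρ.toObs A, ρ.toObs (lindbladDual W A)⟫_ℂ := by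
    rw [h.symmetric hW, ρ.inner_toObs, hW.lindbladDual_star]
  have h3 : trace ((lindbladDual W (star A * A) - star A * lindbladDual W A
      - lindbladDual W (star A) * A) * ρ.op)
      = -2 * ⟪ρ.toObs A, ρ.toObs (lindbladDual W A)⟫_ℂ := by
    rw [← ρ.functional_apply, map_sub, map_sub, ρ.functional_apply, ρ.functional_apply,
      ρ.functional_apply, h1, h2, ← ρ.inner_toObs]
    ring
  rw [h3] at hs
  convert! hs using 1
  ring

theorem QDB.re_inner_nonpos (h : QDB W ρ) (hW : ColBounded W) (A : ℋ →L[ℂ] ℋ) :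
    (⟪ρ.toObs A, ρ.toObs (lindbladDual W A)⟫_ℂ).re ≤ 0 := by
  refine hasSum_le (fun j => ?_) (Complex.hasSum_re (h.hasSum_commutator hW A)) hasSum_zero
  rw [← ρ.inner_toObs, inner_self_eq_norm_sq_to_K]
  have : -(1 / 2 : ℂ) * ((‖ρ.toObs (W j * A - A * W j)‖ : ℝ) : ℂ) ^ 2
      = ((-(1 / 2) * ‖ρ.toObs (W j * A - A * W j)‖ ^ 2 : ℝ) : ℂ) := by push_cast; ring
  erw [this]
  rw [Complex.ofReal_re]
  nlinarith [sq_nonneg ‖ρ.toObs (W j * A - A * W j)‖]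

theorem QDB.exists_extension (h : QDB W ρ) (hW : ColBounded W) :
    ∃ G' : ρ.ObsSpace →L[ℂ] ρ.ObsSpace, (∀ A, G' (ρ.toObs A) = ρ.toObs (lindbladDual W A)) ∧
      IsSelfAdjoint G' ∧ G' ≤ 0 := by
  obtain ⟨c, hc⟩ := ρ.exists_norm_toObs_le
  obtain ⟨K, hK⟩ := hW.exists_norm_lindbladDual_le
  -- A strictly positive constant is needed for the growth comparison.
  have hK' : ∀ A, ‖lindbladDual W A‖ ≤ (|K| + 1) * ‖A‖ := fun A =>
    (hK A).trans (mul_le_mul_of_nonneg_right ((le_abs_self K).trans (by linarith)) (norm_nonneg A))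
  exact exists_extension_of_symmetric ρ.toObs hW.lindbladDualₗ ρ.denseRange_toObs
    (norm_map_le_of_symmetric ρ.toObs hW.lindbladDualₗ (by positivity) hc hK' (h.symmetric hW))
    (h.symmetric hW) (h.re_inner_nonpos hW)

end DetailedBalance

/-! ### Eigenvectors of the Hamiltonian -/

theorem IsHeatCurve.shift {H : ℋ →ₗ.[ℂ] ℋ} {s a b : ℝ} {u : ℝ → ℋ} (hu : IsHeatCurve H s u)
    (ha : 0 ≤ a) (hb : b ≤ s) : IsHeatCurve H (b - a) fun t => u (a + t) := by
  refine ⟨hu.continuousOn.comp (by fun_prop) fun t ht =>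
    ⟨by linarith [ht.1], by linarith [ht.2]⟩, fun t ht => ?_⟩
  obtain ⟨h, hd⟩ := hu.ode (a + t) ⟨by linarith [ht.1], by linarith [ht.2]⟩
  exact ⟨h, hd.comp_const_add a t⟩

/-- If a heat curve returns to a positive multiple `c` of its initial value, then at half time it is
`√c` times the initial value. Indeed `⟪w a, w b⟫` depends only on `a + b`; the Cauchy-Schwarz
inequality for `w (r / 4)` and `w (3 r / 4)` bounds `⟪w (r / 2), w 0⟫` from below by `√c ‖w 0‖²`, which
is what is needed for `‖w (r / 2) - √c w 0‖ ≤ 0`. -/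
theorem IsHeatCurve.half_eq {H : ℋ →ₗ.[ℂ] ℋ} (hH : IsSelfAdjoint H) {r : ℝ} (hr : 0 ≤ r)
    {w : ℝ → ℋ} (hw : IsHeatCurve H r w) {c : ℝ} (hc : 0 < c) (h : w r = (c : ℂ) • w 0) :
    w (r / 2) = (√c : ℂ) • w 0 := by
  have hg : ⟪w r, w 0⟫_ℂ = ((c * ‖w 0‖ ^ 2 : ℝ) : ℂ) := by
    rw [h, inner_smul_left, inner_self_eq_norm_sq_to_K, Complex.conj_ofReal]
    push_cast; rfl
  have h1 : ((‖w (r / 2)‖ ^ 2 : ℝ) : ℂ) = ((c * ‖w 0‖ ^ 2 : ℝ) : ℂ) := by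
    rw [← hw.inner_half hH hr, hg]
  have h1' : ‖w (r / 2)‖ ^ 2 = c * ‖w 0‖ ^ 2 := Complex.ofReal_injective h1
  have h2 : ⟪w (r / 2), w 0⟫_ℂ = ((‖w (r / 4)‖ ^ 2 : ℝ) : ℂ) := by
    have := (hw.mono (r := r / 2) (by linarith)).inner_half hH (by linarith)
    rwa [show r / 2 / 2 = r / 4 by ring] at this
  have h3 : ‖w (3 * r / 4)‖ ^ 2 = c * ‖w (r / 4)‖ ^ 2 := by
    have := (hw.shift (a := r / 2) (b := r) (by linarith) le_rfl).inner_half hH (by linarith)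
    rw [show r / 2 + (r - r / 2) = r by ring, show r / 2 + 0 = r / 2 by ring,
      show r / 2 + (r - r / 2) / 2 = 3 * r / 4 by ring, h, inner_smul_left,
      ← inner_conj_symm, h2, Complex.conj_ofReal, Complex.conj_ofReal] at this
    exact_mod_cast this.symm
  have h4 : c * ‖w 0‖ ^ 2 ≤ ‖w (r / 4)‖ * ‖w (3 * r / 4)‖ := by
    have := hw.inner_const hH hw (t := r / 4) ⟨by linarith, by linarith⟩
    rw [hg, show r - r / 4 = 3 * r / 4 by ring] at this
    have h5 := norm_inner_le_norm (𝕜 := ℂ) (w (r / 4)) (w (3 * r / 4))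
    rw [this, Complex.norm_real, Real.norm_of_nonneg (by positivity)] at h5
    exact h5
  have h3' : ‖w (3 * r / 4)‖ = √c * ‖w (r / 4)‖ := by
    rw [← abs_of_nonneg (norm_nonneg (w (3 * r / 4))), ← Real.sqrt_sq_eq_abs, h3,
      Real.sqrt_mul hc.le, Real.sqrt_sq (norm_nonneg _)]
  have hsc : √c * √c = c := Real.mul_self_sqrt hc.le
  have hsp : 0 < √c := Real.sqrt_pos.2 hc
  have h5 : √c * ‖w 0‖ ^ 2 ≤ ‖w (r / 4)‖ ^ 2 := by
    rw [h3'] at h4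
    refine le_of_mul_le_mul_left ?_ hsp
    calc √c * (√c * ‖w 0‖ ^ 2) = c * ‖w 0‖ ^ 2 := by rw [← mul_assoc, hsc]
      _ ≤ _ := h4
      _ = _ := by ring
  have h6 : ‖w (r / 2) - (√c : ℂ) • w 0‖ ^ 2 ≤ 0 := by
    rw [norm_sub_sq (𝕜 := ℂ), inner_smul_right, h2, norm_smul, Complex.norm_real,
      Real.norm_of_nonneg hsp.le, mul_pow, h1', sq (√c), hsc]
    have : RCLike.re ((√c : ℂ) * ((‖w (r / 4)‖ ^ 2 : ℝ) : ℂ)) = √c * ‖w (r / 4)‖ ^ 2 := by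
      rw [← Complex.ofReal_mul]; exact Complex.ofReal_re _
    rw [this]
    nlinarith [mul_le_mul_of_nonneg_left h5 hsp.le]
  exact sub_eq_zero.1 (norm_eq_zero.1 (pow_eq_zero_iff two_ne_zero |>.1
    (le_antisymm h6 (sq_nonneg _))))

/-- A closed set of reals that contains the endpoints of an interval and is stable under midpoints
contains the interval. -/
theorem Icc_subset_of_midpoint {S : Set ℝ} {s : ℝ} (hS : IsClosed S) (h0 : 0 ∈ S)
    (h1 : s ∈ S) (hmid : ∀ a ∈ S, ∀ b ∈ S, (a + b) / 2 ∈ S) : Icc 0 s ⊆ S := by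
  intro t ht
  by_contra htS
  have hl : IsCompact (S ∩ Icc 0 t) := isCompact_Icc.inter_left hS
  have hr : IsCompact (S ∩ Icc t s) := isCompact_Icc.inter_left hS
  -- The gap of `S` around `t` is bounded by points of `S`, whose midpoint lies in the gap.
  obtain ⟨a, ha, hamax⟩ := hl.exists_isGreatest ⟨0, h0, le_rfl, ht.1⟩
  obtain ⟨b, hb, hbmin⟩ := hr.exists_isLeast ⟨s, h1, ht.2, le_rfl⟩
  have hat : a < t := lt_of_le_of_ne ha.2.2 fun h => htS (h ▸ ha.1)
  have htb : t < b := lt_of_le_of_ne hb.2.1 fun h => htS (h ▸ hb.1)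
  have hm := hmid a ha.1 b hb.1
  rcases le_total ((a + b) / 2) t with h | h
  · linarith [hamax ⟨hm, by linarith [ha.2.1], h⟩]
  · linarith [hbmin ⟨hm, h, by linarith [hb.2.2]⟩]

/-- A heat curve from `e` to `e^{-s μ} e` is `t ↦ e^{-t μ} e`. -/
theorem IsHeatCurve.eq_exp {H : ℋ →ₗ.[ℂ] ℋ} (hH : IsSelfAdjoint H) {s : ℝ} (hs : 0 ≤ s)
    {u : ℝ → ℋ} (hu : IsHeatCurve H s u) {μ : ℝ} (h : u s = (Real.exp (-s * μ) : ℂ) • u 0)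
    {t : ℝ} (ht : t ∈ Icc 0 s) : u t = (Real.exp (-t * μ) : ℂ) • u 0 := by
  set S : Set ℝ := {t ∈ Icc 0 s | u t = (Real.exp (-t * μ) : ℂ) • u 0} with hSdef
  have hS : IsClosed S := by
    have h1 : ContinuousOn (fun t => u t - (Real.exp (-t * μ) : ℂ) • u 0) (Icc 0 s) :=
      hu.continuousOn.sub (by fun_prop)
    have h2 := h1.preimage_isClosed_of_isClosed isClosed_Icc (isClosed_singleton (x := (0 : ℋ)))
    convert! h2 using 1
    ext t
    simp [hSdef, sub_eq_zero]
  refine (Icc_subset_of_midpoint hS ⟨⟨le_rfl, hs⟩, by simp⟩ ⟨⟨hs, le_rfl⟩, h⟩ ?_ ht).2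
  suffices hle : ∀ a ∈ S, ∀ b ∈ S, a ≤ b → (a + b) / 2 ∈ S by
    intro a ha b hb
    rcases le_total a b with hab | hab
    · exact hle a ha b hb hab
    · rw [add_comm]; exact hle b hb a ha hab
  rintro a ⟨ha, hua⟩ b ⟨hb, hub⟩ hab
  refine ⟨⟨by linarith [ha.1, hb.1], by linarith [ha.2, hb.2]⟩, ?_⟩
  have hw := hu.shift ha.1 hb.2
  have h1 := hw.half_eq hH (by linarith) (c := Real.exp (-(b - a) * μ)) (Real.exp_pos _) (by
    rw [add_sub_cancel, add_zero, hua, hub, smul_smul, ← Complex.ofReal_mul, ← Real.exp_add]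
    congr 3; ring)
  rw [add_zero, hua, smul_smul, ← Real.exp_half, ← Complex.ofReal_mul, ← Real.exp_add] at h1
  rw [show (a + b) / 2 = a + (b - a) / 2 by ring, h1]
  congr 3; ring

/-- An eigenvector `e` of `e^{-sH}` is an eigenvector of `H`: the heat curve `t ↦ e^{-t μ} e` lies in the
domain at the interior time `s / 2`, and its derivative there is `-H` of its value. -/
theorem IsExpNeg.apply_eigenvector {H : ℋ →ₗ.[ℂ] ℋ} (hH : IsSelfAdjoint H) {s : ℝ} (hs : 0 < s)
    {R : ℋ →L[ℂ] ℋ} (hR : IsExpNeg H s R) {e : ℋ} {μ : ℝ}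
    (he : R e = (Real.exp (-s * μ) : ℂ) • e) : ∃ h : e ∈ H.domain, H ⟨e, h⟩ = (μ : ℂ) • e := by
  obtain ⟨u, hu, h0, h1⟩ := hR e
  have hu' : ∀ t ∈ Icc 0 s, u t = (Real.exp (-t * μ) : ℂ) • e := fun t ht => by
    rw [hu.eq_exp hH hs.le (μ := μ) (by rw [h0, h1, he]) ht, h0]
  have hmem : s / 2 ∈ Ioo 0 s := ⟨by linarith, by linarith⟩
  obtain ⟨hd, hder⟩ := hu.ode (s / 2) hmem
  set c : ℂ := (Real.exp (-(s / 2) * μ) : ℂ) with hc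
  have hc0 : c ≠ 0 := Complex.ofReal_ne_zero.2 (Real.exp_pos _).ne'
  have hut : u (s / 2) = c • e := hu' _ (Ioo_subset_Icc_self hmem)
  have hd2 : HasDerivAt (fun t : ℝ => (Real.exp (-t * μ) : ℂ) • e) ((c * -μ) • e) (s / 2) := by
    have h2 : HasDerivAt (fun t : ℝ => Real.exp (-t * μ)) (Real.exp (-(s / 2) * μ) * -μ) (s / 2) := by
      have := ((hasDerivAt_id (s / 2)).neg.mul_const μ).exp
      simpa using this
    have := h2.ofReal_comp.smul_const e
    simpa [hc] using this
  have hd3 : HasDerivAt u ((c * -μ) • e) (s / 2) :=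
    hd2.congr_of_eventuallyEq (eventually_of_mem (Ioo_mem_nhds hmem.1 hmem.2)
      fun t ht => hu' t (Ioo_subset_Icc_self ht))
  have hH' := hder.unique hd3
  have hed : e ∈ H.domain := by
    rw [hut] at hd
    exact (H.domain.smul_mem_iff hc0).1 hd
  refine ⟨hed, ?_⟩
  have h3 : H ⟨u (s / 2), hd⟩ = c • H ⟨e, hed⟩ := by
    rw [← H.map_smul]
    congr 1
    exact Subtype.ext hut
  rw [h3, neg_eq_iff_eq_neg, ← neg_smul, mul_neg, neg_neg, mul_smul] at hH'
  exact smul_right_injective _ hc0 hH'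

/-! ### An eigenbasis of the Gibbs state -/

open Classical in
theorem hasSum_ite_compl {ι : Type*} {g : ι → ℝ} {t : ℝ} (hg : HasSum g t) (F : Finset ι) :
    HasSum (fun i => if i ∈ F then 0 else g i) (t - ∑ i ∈ F, g i) := by
  have h1 : HasSum (fun i => if i ∈ F then g i else 0) (∑ i ∈ F, g i) := by
    have : HasSum (fun i => if i ∈ F then g i else 0) (∑ i ∈ F, if i ∈ F then g i else 0) :=
      hasSum_sum_of_ne_finset_zero fun i hi => if_neg hi
    rwa [Finset.sum_congr rfl fun i hi => if_pos hi] at this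
  refine (hg.sub h1).congr_fun fun i => ?_
  split_ifs <;> simp

/-- An operator with Hilbert-Schmidt adjoint is the norm limit of its finite-rank compressions
`∑_{i ∈ F} |eᵢ⟩⟨T* eᵢ|`. -/
theorem IsHilbertSchmidt.isCompactOperator {T : ℋ →L[ℂ] ℋ} (hT : IsHilbertSchmidt (star T)) :
    IsCompactOperator T := by
  classical
  set g : BasisIndex ℋ → ℝ := fun i => ‖(star T) (onb ℋ i)‖ ^ 2 with hg
  set S : Finset (BasisIndex ℋ) → ℋ →L[ℂ] ℋ := fun F =>
    ∑ i ∈ F, InnerProductSpace.rankOne ℂ (onb ℋ i) ((star T) (onb ℋ i)) with hS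
  have hgs : HasSum g (∑' i, g i) := Summable.hasSum hT
  have hbound : ∀ F, ‖S F - T‖ ≤ √(∑' i, g i - ∑ i ∈ F, g i) := fun F => by
    have htail := hasSum_ite_compl hgs F
    have hnn : 0 ≤ ∑' i, g i - ∑ i ∈ F, g i :=
      htail.nonneg fun i => by split_ifs <;> positivity
    refine ContinuousLinearMap.opNorm_le_bound _ (Real.sqrt_nonneg _) fun x => ?_
    refine abs_le_of_sq_le_sq' ?_ (by positivity) |>.2
    rw [mul_pow, Real.sq_sqrt hnn]
    refine hasSum_le (fun i => ?_) (hasSum_norm_sq_inner (onb ℋ) _) (htail.mul_right _)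
    have hin : ⟪onb ℋ i, S F x⟫_ℂ = if i ∈ F then ⟪onb ℋ i, T x⟫_ℂ else 0 := by
      rw [hS, sum_apply, inner_sum]
      simp only [InnerProductSpace.rankOne_apply, inner_smul_right,
        orthonormal_iff_ite.1 (onb ℋ).orthonormal i, ContinuousLinearMap.star_eq_adjoint,
        ContinuousLinearMap.adjoint_inner_left, mul_ite, mul_one, mul_zero, Finset.sum_ite_eq]
    rw [sub_apply, inner_sub_right, hin]
    split_ifs
    · simp
    · rw [zero_sub, norm_neg, ← mul_pow, ← ContinuousLinearMap.adjoint_inner_left]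
      exact pow_le_pow_left₀ (norm_nonneg _) (norm_inner_le_norm _ _) 2
  have hlim : Tendsto S atTop (𝓝 T) := by
    refine tendsto_iff_norm_sub_tendsto_zero.2
      (squeeze_zero (fun F => norm_nonneg _) hbound ?_)
    have h1 : Tendsto (fun F => ∑ i ∈ F, g i) atTop (𝓝 (∑' i, g i)) := hgs
    have h2 := (Real.continuous_sqrt.tendsto _).comp (h1.const_sub (∑' i, g i))
    simpa [Function.comp_def] using h2
  refine isCompactOperator_of_tendsto hlim (Eventually.of_forall fun F => ?_)
  rw [hS]
  refine Finset.sum_induction _ (fun A : ℋ →L[ℂ] ℋ => IsCompactOperator A)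
    (fun A B hA hB => hA.add hB) isCompactOperator_zero fun i _ => ?_
  rw [InnerProductSpace.rankOne_def']
  have hid : IsCompactOperator (ContinuousLinearMap.id ℂ ℂ) := isCompactOperator_id
  exact (hid.comp_clm (innerSL ℂ ((star T) (onb ℋ i)))).clm_comp
    (ContinuousLinearMap.toSpanSingleton ℂ (onb ℋ i))

theorem PosTraceClass.isCompactOperator (ρ : PosTraceClass ℋ) : IsCompactOperator ρ.op := by
  have h : IsCompactOperator (CFC.sqrt ρ.op : ℋ →L[ℂ] ℋ) :=
    IsHilbertSchmidt.isCompactOperator (by rw [ρ.sqrt_star]; exact ρ.isHilbertSchmidt_sqrt)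
  rw [← CFC.sqrt_mul_sqrt_self ρ.op ρ.nonneg]
  exact h.clm_comp (CFC.sqrt ρ.op)

/-- The spectral theorem for a positive, injective, trace-class operator. -/
theorem PosTraceClass.exists_eigenbasis {ℋ : Type u} [NormedAddCommGroup ℋ] [InnerProductSpace ℂ ℋ]
    [CompleteSpace ℋ] (ρ : PosTraceClass ℋ) (hinj : ∀ x, ρ.op x = 0 → x = 0) :
    ∃ (ι : Type u) (f : HilbertBasis ι ℂ ℋ) (p : ι → ℝ),
      ∀ l, 0 < p l ∧ ρ.op (f l) = (p l : ℂ) • f l := by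
  have hpos := (ContinuousLinearMap.nonneg_iff_isPositive _).1 ρ.nonneg
  have hsymm : (ρ.op : ℋ →ₗ[ℂ] ℋ).IsSymmetric := hpos.isSymmetric
  let E : ℂ → Submodule ℂ ℋ := fun μ => Module.End.eigenspace (ρ.op : ℋ →ₗ[ℂ] ℋ) μ
  have hE : ∀ μ x, x ∈ E μ ↔ ρ.op x = μ • x := fun μ x => Module.End.mem_eigenspace_iff
  have hcl : ∀ μ, CompleteSpace (E μ) := fun μ => by
    refine IsComplete.completeSpace_coe (s := (E μ : Set ℋ)) (IsClosed.isComplete ?_)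
    have : (E μ : Set ℋ) = {x | ρ.op x = μ • x} := by ext x; exact hE μ x
    rw [this]
    exact isClosed_eq (by fun_prop) (by fun_prop)
  choose w b hb using fun μ => exists_hilbertBasis ℂ (E μ)
  have horth : Orthonormal ℂ fun a : Σ μ, w μ => ((b a.1 a.2 : E a.1) : ℋ) :=
    hsymm.orthogonalFamily_eigenspaces.orthonormal_sigma_orthonormal
      (v_family := fun μ => b μ) fun μ => (b μ).orthonormal
  have hbot : (Submodule.span ℂ (Set.range fun a : Σ μ, w μ => ((b a.1 a.2 : E a.1) : ℋ)))ᗮ = ⊥ := by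
    rw [Submodule.eq_bot_iff]
    intro x hx
    rw [Submodule.mem_orthogonal] at hx
    have hx2 : x ∈ (⨆ μ, E μ)ᗮ := by
      rw [← Submodule.iInf_orthogonal, Submodule.mem_iInf]
      intro μ
      rw [Submodule.mem_orthogonal]
      intro y hy
      have hs := (b μ).hasSum_repr ⟨y, hy⟩
      have hs2 := ((innerSL ℂ x) ∘L (E μ).subtypeL).hasSum hs
      have hz : ⟪x, y⟫_ℂ = 0 := by
        refine hs2.unique ?_
        convert! hasSum_zero using 2 with i
        have h1 := hx _ (Submodule.subset_span ⟨⟨μ, i⟩, rfl⟩)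
        have h2 : ⟪x, ((b μ i : E μ) : ℋ)⟫_ℂ = 0 := by
          rw [← inner_conj_symm, h1, map_zero]
        simp [h2]
      rw [← inner_conj_symm, hz, map_zero]
    have := ContinuousLinearMap.orthogonalComplement_iSup_eigenspaces_eq_bot
      ρ.isCompactOperator hsymm
    rw [this] at hx2
    exact (Submodule.mem_bot ℂ).1 hx2
  refine ⟨Σ μ, w μ, HilbertBasis.mkOfOrthogonalEqBot horth hbot, fun a => a.1.re, fun a => ?_⟩
  rw [HilbertBasis.coe_mkOfOrthogonalEqBot]
  have hev : ρ.op (b a.1 a.2 : E a.1) = a.1 • ((b a.1 a.2 : E a.1) : ℋ) := (hE _ _).1 (b a.1 a.2).2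
  have hn : ‖((b a.1 a.2 : E a.1) : ℋ)‖ = 1 := horth.1 a
  have hnn : 0 ≤ a.1 := by
    have := hpos.inner_nonneg_right ((b a.1 a.2 : E a.1) : ℋ)
    rw [hev, inner_smul_right, inner_self_eq_norm_sq_to_K, hn] at this
    simpa using this
  have hre : ((a.1.re : ℝ) : ℂ) = a.1 := (Complex.eq_re_of_ofReal_le (r := 0) (by simpa using hnn)).symm
  refine ⟨lt_of_le_of_ne (Complex.nonneg_iff.1 hnn).1 fun h0 => ?_, by rw [hre]; exact hev⟩
  have h0' : a.1.re = 0 := h0.symm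
  have h2 : a.1 = 0 := by rw [← hre, h0', Complex.ofReal_zero]
  have h1 : ((b a.1 a.2 : E a.1) : ℋ) = 0 := hinj _ (hev.trans (smul_eq_zero_of_left h2 _))
  rw [h1, norm_zero] at hn
  exact zero_ne_one hn

/-- The Gibbs state and the Hamiltonian have a common orthonormal basis of eigenvectors. -/
theorem ConditionH.exists_eigenbasis {ℋ : Type u} [NormedAddCommGroup ℋ] [InnerProductSpace ℂ ℋ]
    [CompleteSpace ℋ] [Nontrivial ℋ] {H : ℋ →ₗ.[ℂ] ℋ} {τ : ℝ} (hH : ConditionH H τ) :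
    ∃ (ι : Type u) (f : HilbertBasis ι ℂ ℋ) (p ε : ι → ℝ), ∀ l, 0 < p l ∧
      hH.gibbs.op (f l) = (p l : ℂ) • f l ∧
      ∃ h : f l ∈ H.domain, H ⟨f l, h⟩ = (ε l : ℂ) • f l := by
  have hZ := hH.partition_ne_zero
  have hZ0 := hH.partition_nonneg
  set Z := partitionFunction H τ with hZdef
  have hZre : ((Z.re : ℝ) : ℂ) = Z := (Complex.eq_re_of_ofReal_le (r := 0) (by simpa using hZ0)).symm
  have hZpos : 0 < Z.re := lt_of_le_of_ne (Complex.nonneg_iff.1 hZ0).1 fun h => hZ (by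
    rw [← hZre, ← h, Complex.ofReal_zero])
  have hop : ∀ x, hH.gibbs.op x = Z⁻¹ • expNeg H τ⁻¹ x := fun x => rfl
  have hspec := expNeg_spec hH.exp_bounded
  have hτ := inv_pos.2 hH.temp_pos
  obtain ⟨ι, f, p, hf⟩ := hH.gibbs.exists_eigenbasis fun x hx => by
    rw [hop, smul_eq_zero] at hx
    exact hspec.injective hH.selfAdjoint hτ.le (hx.resolve_left (inv_ne_zero hZ))
  -- `e^{-H/τ}` has eigenvalues `Z p_l = e^{-ε_l/τ}`.
  refine ⟨ι, f, p, fun l => -(τ * Real.log (Z.re * p l)), fun l => ⟨(hf l).1, (hf l).2, ?_⟩⟩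
  refine hspec.apply_eigenvector hH.selfAdjoint hτ ?_
  have h1 : expNeg H τ⁻¹ (f l) = (Z * p l) • f l := by
    have h2 := (hf l).2
    rw [hop, inv_smul_eq_iff₀ hZ, smul_smul] at h2
    exact h2
  rw [h1, neg_mul_neg, inv_mul_cancel_left₀ hH.temp_pos.ne',
    Real.exp_log (mul_pos hZpos (hf l).1), Complex.ofReal_mul, hZre]

/-! ### Unbounded operators that are diagonal in a Hilbert basis -/

/-- An operator with an orthonormal basis of eigenvectors for purely imaginary eigenvalues, which
acts on all of its domain by multiplying the coordinates by the eigenvalues, has an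
anti-self-adjoint closure. The closure is the maximal multiplication operator: the partial sums of
the basis expansion of a point of its graph lie in the graph of the given operator. -/
theorem closure_adjoint_eq_neg_of_diagonal {ι K : Type*} [NormedAddCommGroup K]
    [InnerProductSpace ℂ K] [CompleteSpace K] (T : K →ₗ.[ℂ] K) (b : HilbertBasis ι ℂ K)
    (μ : ι → ℝ) (hb : ∀ n, (b n, (Complex.I * μ n) • b n) ∈ T.graph)
    (hT : ∀ x y, (x, y) ∈ T.graph → ∀ n, ⟪b n, y⟫_ℂ = Complex.I * μ n * ⟪b n, x⟫_ℂ) :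
    Dense (T.domain : Set K) ∧ T.IsClosable ∧ T.closure† = -T.closure := by
  let g : Submodule ℂ (K × K) :=
    { carrier := {q | ∀ n, ⟪b n, q.2⟫_ℂ = Complex.I * μ n * ⟪b n, q.1⟫_ℂ}
      zero_mem' := fun n => by simp
      add_mem' := fun {q r} hq hr n => by
        rw [Prod.snd_add, Prod.fst_add, inner_add_right, inner_add_right, hq n, hr n]; ring
      smul_mem' := fun c q hq n => by
        rw [Prod.smul_snd, Prod.smul_fst, inner_smul_right, inner_smul_right, hq n]; ring }
  have hgmem : ∀ x y, (x, y) ∈ g ↔ ∀ n, ⟪b n, y⟫_ℂ = Complex.I * μ n * ⟪b n, x⟫_ℂ :=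
    fun x y => Iff.rfl
  have hgclosed : IsClosed (g : Set (K × K)) := by
    have : (g : Set (K × K))
        = ⋂ n, {q : K × K | ⟪b n, q.2⟫_ℂ = Complex.I * μ n * ⟪b n, q.1⟫_ℂ} := by
      ext q; simp [g]
    rw [this]
    exact isClosed_iInter fun n => isClosed_eq (by fun_prop) (by fun_prop)
  have hcl : T.graph.topologicalClosure = g := by
    refine le_antisymm (Submodule.topologicalClosure_minimal _ (fun q hq => hT q.1 q.2 hq) hgclosed)
      fun q hq => ?_
    have hx := b.hasSum_repr q.1
    have hy := b.hasSum_repr q.2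
    simp only [b.repr_apply_apply] at hx hy
    refine T.graph.isClosed_topologicalClosure.mem_of_tendsto (hx.prodMk hy)
      (Eventually.of_forall fun F => Submodule.sum_mem _ fun n _ => ?_)
    have h := T.graph.smul_mem ⟪b n, q.1⟫_ℂ (hb n)
    refine T.graph.le_topologicalClosure ?_
    rw [hq n]
    convert! h using 1
    rw [Prod.smul_mk, smul_smul, mul_comm]
  have hggraph : g.toLinearPMap.graph = g := by
    refine Submodule.toLinearPMap_graph_eq _ fun q hq h0 => ?_
    have hz : b.repr q.2 = 0 := by
      ext n
      rw [b.repr_apply_apply, hq n, h0, inner_zero_right, mul_zero]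
      rfl
    exact b.repr.map_eq_zero_iff.1 hz
  have hclosable : T.IsClosable := ⟨g.toLinearPMap, by rw [hcl, hggraph]⟩
  have hclg : T.closure.graph = g := by rw [← hclosable.graph_closure_eq_closure_graph, hcl]
  have hdense : Dense (T.domain : Set K) := by
    have h1 : Submodule.span ℂ (Set.range b) ≤ T.domain := by
      rw [Submodule.span_le]
      rintro _ ⟨n, rfl⟩
      exact LinearPMap.mem_domain_of_mem_graph (hb n)
    have h2 : Dense ((Submodule.span ℂ (Set.range b) : Submodule ℂ K) : Set K) :=
      Submodule.dense_iff_topologicalClosure_eq_top.2 b.dense_span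
    exact h2.mono h1
  have hdense' : Dense (T.closure.domain : Set K) := hdense.mono T.le_closure.1
  refine ⟨hdense, hclosable, LinearPMap.eq_of_eq_graph ?_⟩
  have hneg : ∀ y z, (y, z) ∈ (-T.closure).graph ↔ (y, -z) ∈ g := fun y z => by
    rw [← hclg, LinearPMap.neg_graph]
    constructor
    · rintro ⟨⟨a, c⟩, hac, h⟩
      simp only [LinearMap.prodMap_apply, LinearMap.id_apply, LinearMap.neg_apply,
        Prod.mk.injEq] at h
      rw [← h.1, ← h.2, neg_neg]
      exact hac
    · intro h
      exact ⟨(y, -z), h, by simp⟩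
  ext ⟨y, z⟩
  rw [hneg, hgmem, LinearPMap.adjoint_graph_eq_graph_adjoint hdense', hclg,
    Submodule.mem_adjoint_iff]
  constructor
  · intro h n
    have h1 := h (b n) ((Complex.I * μ n) • b n) (hcl ▸ T.graph.le_topologicalClosure (hb n))
    simp only [inner_smul_left, map_mul, Complex.conj_I, Complex.conj_ofReal] at h1
    rw [inner_neg_right]
    linear_combination h1
  · intro h a c hac
    rw [sub_eq_zero]
    refine ((b.hasSum_inner_mul_inner c y).congr_fun fun n => ?_).unique
      (b.hasSum_inner_mul_inner a z)
    have h1 := h n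
    have h2 := congrArg (starRingEnd ℂ) ((hgmem a c).1 hac n)
    rw [inner_neg_right] at h1
    simp only [map_mul, inner_conj_symm, Complex.conj_I, Complex.conj_ofReal] at h2
    rw [h2]
    linear_combination (-⟪a, b n⟫_ℂ) * h1

/-! ### Matrix units as a Hilbert basis of the completion -/

theorem IsHilbertSchmidt.summable_norm_sq_inner {ι : Type*} (f : HilbertBasis ι ℂ ℋ)
    {V : ℋ →L[ℂ] ℋ} (hV : IsHilbertSchmidt V) :
    Summable fun q : BasisIndex ℋ × ι => ‖⟪f q.2, V (onb ℋ q.1)⟫_ℂ‖ ^ 2 := by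
  have e : ∀ i, ∑' l, ‖⟪f l, V (onb ℋ i)⟫_ℂ‖ ^ 2 = ‖V (onb ℋ i)‖ ^ 2 := fun i =>
    (hasSum_norm_sq_inner f _).tsum_eq
  refine (summable_prod_of_nonneg
    (f := fun q : BasisIndex ℋ × ι => ‖⟪f q.2, V (onb ℋ q.1)⟫_ℂ‖ ^ 2) fun q => sq_nonneg _).2
    ⟨fun i => (hasSum_norm_sq_inner f (V (onb ℋ i))).summable, ?_⟩
  simp only [e]
  exact hV

namespace PosTraceClass

variable (ρ : PosTraceClass ℋ) {ι : Type*} (f : HilbertBasis ι ℂ ℋ) {p : ι → ℝ}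

/-- The trace `Tr(C ρ)` computed in a basis of eigenvectors of `ρ`. -/
theorem hasSum_trace_eigenbasis (hf : ∀ l, ρ.op (f l) = (p l : ℂ) • f l) (C : ℋ →L[ℂ] ℋ) :
    HasSum (fun l => (p l : ℂ) * ⟪f l, C (f l)⟫_ℂ) (trace (C * ρ.op)) := by
  obtain ⟨T, hTdef⟩ : ∃ T, T = CFC.sqrt ρ.op := ⟨_, rfl⟩
  have hTT : T * T = ρ.op := by rw [hTdef, CFC.sqrt_mul_sqrt_self ρ.op ρ.nonneg]
  have hTs : ∀ x y, ⟪T x, y⟫_ℂ = ⟪x, T y⟫_ℂ := fun x y => by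
    conv_lhs => rw [← ContinuousLinearMap.adjoint_inner_right,
      ← ContinuousLinearMap.star_eq_adjoint, hTdef, ρ.sqrt_star, ← hTdef]
  have hT : IsHilbertSchmidt T := hTdef ▸ ρ.isHilbertSchmidt_sqrt
  have hCT : IsHilbertSchmidt (star C * T) := hs_comp (star C) hT
  have hs : Summable fun q : BasisIndex ℋ × ι =>
      ⟪(star C * T) (onb ℋ q.1), f q.2⟫_ℂ * ⟪f q.2, T (onb ℋ q.1)⟫_ℂ := by
    refine Summable.of_norm_bounded
      ((hCT.summable_norm_sq_inner f).add (hT.summable_norm_sq_inner f)) fun q => ?_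
    rw [norm_mul, norm_inner_symm]
    nlinarith [sq_nonneg (‖⟪f q.2, (star C * T) (onb ℋ q.1)⟫_ℂ‖ - ‖⟪f q.2, T (onb ℋ q.1)⟫_ℂ‖),
      sq_nonneg ‖⟪f q.2, (star C * T) (onb ℋ q.1)⟫_ℂ‖, sq_nonneg ‖⟪f q.2, T (onb ℋ q.1)⟫_ℂ‖]
  have h1 : HasSum (fun i => ⟪(star C * T) (onb ℋ i), T (onb ℋ i)⟫_ℂ)
      (∑' q : BasisIndex ℋ × ι, ⟪(star C * T) (onb ℋ q.1), f q.2⟫_ℂ * ⟪f q.2, T (onb ℋ q.1)⟫_ℂ) :=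
    hs.hasSum.prod_fiberwise fun i =>
      f.hasSum_inner_mul_inner ((star C * T) (onb ℋ i)) (T (onb ℋ i))
  have htr : HasSum (fun i => ⟪(star C * T) (onb ℋ i), T (onb ℋ i)⟫_ℂ) (trace (C * ρ.op)) := by
    have h2 := (ρ.trace_mul C).2
    have h3 := h2.1.hasSum
    rw [← h2.2, ← hTdef] at h3
    refine h3.congr_fun fun i => ?_
    simp only [mul_apply_eq_comp]
    rw [ContinuousLinearMap.star_eq_adjoint, ContinuousLinearMap.adjoint_inner_left]
  rw [htr.unique h1]
  have hsw : HasSum (fun q : ι × BasisIndex ℋ =>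
      ⟪(star C * T) (onb ℋ q.2), f q.1⟫_ℂ * ⟪f q.1, T (onb ℋ q.2)⟫_ℂ)
      (∑' q : BasisIndex ℋ × ι, ⟪(star C * T) (onb ℋ q.1), f q.2⟫_ℂ * ⟪f q.2, T (onb ℋ q.1)⟫_ℂ) :=
    (Equiv.prodComm ι (BasisIndex ℋ)).hasSum_iff.2 hs.hasSum
  refine hsw.prod_fiberwise fun l => ?_
  have h4 := (onb ℋ).hasSum_inner_mul_inner (T (f l)) (T (C (f l)))
  have h5 : ⟪T (f l), T (C (f l))⟫_ℂ = p l * ⟪f l, C (f l)⟫_ℂ := by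
    rw [← hTs, ← mul_apply_eq_comp, hTT, hf, inner_smul_left, Complex.conj_ofReal]
  rw [h5] at h4
  refine h4.congr_fun fun i => ?_
  rw [mul_apply_eq_comp, ContinuousLinearMap.star_eq_adjoint,
    ContinuousLinearMap.adjoint_inner_left, hTs, ← hTs (f l), mul_comm]

variable (hf : ∀ l, ρ.op (f l) = (p l : ℂ) • f l)
include hf

theorem inner_toObs_rankOne (x : ℋ) (l : ι) (A : ℋ →L[ℂ] ℋ) :
    ⟪ρ.toObs (InnerProductSpace.rankOne ℂ x (f l)), ρ.toObs A⟫_ℂ = p l * ⟪x, A (f l)⟫_ℂ := by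
  rw [ρ.inner_toObs]
  refine (ρ.hasSum_trace_eigenbasis f hf _).unique ?_
  have e : ∀ m, ⟪f m, (star (InnerProductSpace.rankOne ℂ x (f l)) * A) (f m)⟫_ℂ
      = ⟪x, A (f m)⟫_ℂ * ⟪f m, f l⟫_ℂ := fun m => by
    rw [ContinuousLinearMap.star_eq_adjoint, InnerProductSpace.adjoint_rankOne, mul_apply_eq_comp,
      InnerProductSpace.rankOne_apply, inner_smul_right]
  simp only [e]
  have hs := hasSum_single (f := fun m => (p m : ℂ) * (⟪x, A (f m)⟫_ℂ * ⟪f m, f l⟫_ℂ)) l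
    fun m hm => by rw [f.orthonormal.2 hm, mul_zero, mul_zero]
  have hl : ⟪f l, f l⟫_ℂ = 1 := by rw [inner_self_eq_norm_sq_to_K, f.orthonormal.1 l]; simp
  rwa [hl, mul_one] at hs

theorem hasSum_norm_sq_toObs_eigenbasis (A : ℋ →L[ℂ] ℋ) :
    HasSum (fun l => p l * ‖A (f l)‖ ^ 2) (‖ρ.toObs A‖ ^ 2) := by
  have h := Complex.hasSum_re (ρ.hasSum_trace_eigenbasis f hf (star A * A))
  rw [← ρ.inner_toObs, inner_self_eq_norm_sq_to_K] at h
  convert! h using 1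
  · ext l
    rw [mul_apply_eq_comp, ContinuousLinearMap.star_eq_adjoint,
      ContinuousLinearMap.adjoint_inner_right, inner_self_eq_norm_sq_to_K, Complex.re_ofReal_mul]
    norm_cast
  · norm_cast

/-- In the norm of the completion, `A` is the limit of the finite-rank operators
`∑_{l ∈ F} |A f_l⟩⟨f_l|`, and each `|x⟩⟨f_l|` is a limit of combinations of matrix units. -/
theorem toObs_mem_closure_span (A : ℋ →L[ℂ] ℋ) :
    ρ.toObs A ∈ (Submodule.span ℂ (Set.range fun q : ι × ι =>
      ρ.toObs (InnerProductSpace.rankOne ℂ (f q.1) (f q.2)))).topologicalClosure := by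
  classical
  set M := (Submodule.span ℂ (Set.range fun q : ι × ι =>
      ρ.toObs (InnerProductSpace.rankOne ℂ (f q.1) (f q.2)))).topologicalClosure with hM
  have hMcl : IsClosed (M : Set ρ.ObsSpace) := Submodule.isClosed_topologicalClosure _
  have hunit : ∀ k l, ρ.toObs (InnerProductSpace.rankOne ℂ (f k) (f l)) ∈ M := fun k l =>
    Submodule.le_topologicalClosure _ (Submodule.subset_span ⟨(k, l), rfl⟩)
  obtain ⟨c, hc⟩ := ρ.exists_norm_toObs_le
  have hrank : ∀ x l, ρ.toObs (InnerProductSpace.rankOne ℂ x (f l)) ∈ M := fun x l => by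
    let φ : ℋ →L[ℂ] ρ.ObsSpace :=
      ρ.toObs.mkContinuous c hc ∘L (ContinuousLinearMap.smulRightL ℂ ℋ ℋ) (innerSL ℂ (f l))
    have hφ : ∀ x, φ x = ρ.toObs (InnerProductSpace.rankOne ℂ x (f l)) := fun x => rfl
    have hs := φ.hasSum (f.hasSum_repr x)
    rw [← hφ]
    refine hMcl.mem_of_tendsto hs (Eventually.of_forall fun F => Submodule.sum_mem _ fun k _ => ?_)
    rw [map_smul, hφ]
    exact M.smul_mem _ (hunit k l)
  set S : Finset ι → ℋ →L[ℂ] ℋ := fun F =>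
    ∑ l ∈ F, InnerProductSpace.rankOne ℂ (A (f l)) (f l) with hS
  have hSM : ∀ F, ρ.toObs (S F) ∈ M := fun F => by
    rw [hS, map_sum]
    exact Submodule.sum_mem _ fun l _ => hrank _ _
  have hA := ρ.hasSum_norm_sq_toObs_eigenbasis f hf A
  have hdiff : ∀ F, ‖ρ.toObs (S F) - ρ.toObs A‖ ^ 2
      = ‖ρ.toObs A‖ ^ 2 - ∑ l ∈ F, p l * ‖A (f l)‖ ^ 2 := fun F => by
    rw [← map_sub]
    refine (ρ.hasSum_norm_sq_toObs_eigenbasis f hf _).unique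
      ((hasSum_ite_compl hA F).congr_fun fun m => ?_)
    have hm : S F (f m) = if m ∈ F then A (f m) else 0 := by
      rw [hS, sum_apply]
      simp only [InnerProductSpace.rankOne_apply, orthonormal_iff_ite.1 f.orthonormal, ite_smul,
        one_smul, zero_smul, Finset.sum_ite_eq']
    rw [sub_apply, hm]
    split_ifs <;> simp
  refine hMcl.mem_of_tendsto (f := fun F => ρ.toObs (S F)) (b := atTop) ?_
    (Eventually.of_forall hSM)
  refine tendsto_iff_norm_sub_tendsto_zero.2 ?_
  have h1 : Tendsto (fun F => ∑ l ∈ F, p l * ‖A (f l)‖ ^ 2) atTop (𝓝 (‖ρ.toObs A‖ ^ 2)) := hA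
  have h2 := (Real.continuous_sqrt.tendsto _).comp (h1.const_sub (‖ρ.toObs A‖ ^ 2))
  simpa [Function.comp_def, ← hdiff] using h2

/-- The matrix units `|f_k⟩⟨f_l|` of a basis of eigenvectors of `ρ`, divided by `√p_l`, form a Hilbert
basis of the completion. -/
theorem exists_hilbertBasis_matrixUnits (hp : ∀ l, 0 < p l) :
    ∃ b : HilbertBasis (ι × ι) ℂ ρ.ObsSpace, ∀ q,
      b q = (((√(p q.2))⁻¹ : ℝ) : ℂ) • ρ.toObs (InnerProductSpace.rankOne ℂ (f q.1) (f q.2)) := by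
  classical
  set v : ι × ι → ρ.ObsSpace := fun q =>
    (((√(p q.2))⁻¹ : ℝ) : ℂ) • ρ.toObs (InnerProductSpace.rankOne ℂ (f q.1) (f q.2)) with hv
  have hne : ∀ q : ι × ι, (((√(p q.2))⁻¹ : ℝ) : ℂ) ≠ 0 := fun q =>
    Complex.ofReal_ne_zero.2 (inv_ne_zero (Real.sqrt_pos.2 (hp q.2)).ne')
  have horth : Orthonormal ℂ v := by
    rw [orthonormal_iff_ite]
    rintro ⟨k, l⟩ ⟨m, n⟩
    simp only [hv, inner_smul_left, inner_smul_right, Complex.conj_ofReal]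
    rw [ρ.inner_toObs_rankOne f hf, InnerProductSpace.rankOne_apply, inner_smul_right,
      orthonormal_iff_ite.1 f.orthonormal, orthonormal_iff_ite.1 f.orthonormal]
    by_cases hln : n = l
    · subst hln
      by_cases hkm : k = m
      · subst hkm
        simp only [if_true, mul_one]
        rw [← Complex.ofReal_mul, ← Complex.ofReal_mul, ← Complex.ofReal_one]
        congr 1
        have h1 := Real.mul_self_sqrt (hp n).le
        have h2 := (Real.sqrt_pos.2 (hp n)).ne'
        field_simp
        rw [sq, h1]
      · simp [hkm]
    · simp [hln, Ne.symm hln]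
  have htop : ⊤ ≤ (Submodule.span ℂ (Set.range v)).topologicalClosure := by
    intro ξ _
    have hle : Submodule.span ℂ (Set.range fun q : ι × ι =>
        ρ.toObs (InnerProductSpace.rankOne ℂ (f q.1) (f q.2))) ≤ Submodule.span ℂ (Set.range v) := by
      rw [Submodule.span_le]
      rintro _ ⟨q, rfl⟩
      exact (Submodule.smul_mem_iff _ (hne q)).1 (Submodule.subset_span ⟨q, rfl⟩)
    refine ρ.denseRange_toObs.induction_on
      (p := fun ξ => ξ ∈ (Submodule.span ℂ (Set.range v)).topologicalClosure) ξ
      (Submodule.isClosed_topologicalClosure _) fun A => ?_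
    exact Submodule.topologicalClosure_mono hle (ρ.toObs_mem_closure_span f hf A)
  exact ⟨HilbertBasis.mk horth htop, fun q => by rw [HilbertBasis.coe_mk]⟩

end PosTraceClass

/-! ### The Heisenberg generator -/

section Heisenberg

variable {H : ℋ →ₗ.[ℂ] ℋ}

theorem inner_apply_eigenvector (hH : IsSelfAdjoint H) {e : ℋ} {ε : ℝ} (he : e ∈ H.domain)
    (hε : H ⟨e, he⟩ = (ε : ℂ) • e) (x : H.domain) : ⟪e, H x⟫_ℂ = ε * ⟪e, (x : ℋ)⟫_ℂ := by
  have h := H.adjoint_isFormalAdjoint hH.dense_domain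
  rw [LinearPMap.isSelfAdjoint_def.1 hH] at h
  rw [← h ⟨e, he⟩ x, hε, inner_smul_left, Complex.conj_ofReal]

theorem isCommutator_rankOne (hH : IsSelfAdjoint H) {e e' : ℋ} {ε ε' : ℝ} (he : e ∈ H.domain)
    (hε : H ⟨e, he⟩ = (ε : ℂ) • e) (he' : e' ∈ H.domain) (hε' : H ⟨e', he'⟩ = (ε' : ℂ) • e') :
    IsCommutator H (InnerProductSpace.rankOne ℂ e e')
      (((ε - ε' : ℝ) : ℂ) • InnerProductSpace.rankOne ℂ e e') := fun x => by
  refine ⟨H.domain.smul_mem _ he, ?_⟩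
  have h1 : H ⟨InnerProductSpace.rankOne ℂ e e' x, H.domain.smul_mem _ he⟩
      = ⟪e', (x : ℋ)⟫_ℂ • H ⟨e, he⟩ := H.map_smul ⟪e', (x : ℋ)⟫_ℂ ⟨e, he⟩
  rw [h1, hε, InnerProductSpace.rankOne_apply, inner_apply_eigenvector hH he' hε', smul_apply,
    InnerProductSpace.rankOne_apply, smul_smul, smul_smul, ← sub_smul]
  congr 1
  push_cast
  ring

theorem IsCommutator.inner_apply (hH : IsSelfAdjoint H) {e e' : ℋ} {ε ε' : ℝ} (he : e ∈ H.domain)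
    (hε : H ⟨e, he⟩ = (ε : ℂ) • e) (he' : e' ∈ H.domain) (hε' : H ⟨e', he'⟩ = (ε' : ℂ) • e')
    {A C : ℋ →L[ℂ] ℋ} (h : IsCommutator H A C) :
    ⟪e, C e'⟫_ℂ = ((ε - ε' : ℝ) : ℂ) * ⟪e, A e'⟫_ℂ := by
  obtain ⟨h1, h2⟩ := h ⟨e', he'⟩
  simp only at h1 h2
  rw [← h2, inner_sub_right, inner_apply_eigenvector hH he hε, hε', map_smul, inner_smul_right]
  push_cast
  ring

/-- `L₀'` acts on the matrix units `|f_k⟩⟨f_l|` as multiplication by `i (ε_k - ε_l)`. -/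
theorem heisenbergGen_closure_adjoint [Nontrivial ℋ] {τ : ℝ} (hH : ConditionH H τ) :
    Dense ((heisenbergGen hH).domain : Set hH.gibbs.ObsSpace) ∧ (heisenbergGen hH).IsClosable ∧
      (heisenbergGen hH).closure† = -(heisenbergGen hH).closure := by
  obtain ⟨ι, f, p, ε, hf⟩ := hH.exists_eigenbasis
  have hρ : ∀ l, hH.gibbs.op (f l) = (p l : ℂ) • f l := fun l => (hf l).2.1
  choose hd hε using fun l => (hf l).2.2
  obtain ⟨b, hb⟩ := hH.gibbs.exists_hilbertBasis_matrixUnits f hρ fun l => (hf l).1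
  refine closure_adjoint_eq_neg_of_diagonal _ b (fun q => ε q.1 - ε q.2) (fun q => ?_)
    fun x y hxy q => ?_
  · rw [heisenbergGen_graph, hb]
    set c : ℂ := (((√(p q.2))⁻¹ : ℝ) : ℂ)
    set E := InnerProductSpace.rankOne ℂ (f q.1) (f q.2)
    have h1 : (E, Complex.I • ((ε q.1 - ε q.2 : ℝ) : ℂ) • E) ∈ heisenbergGraph H :=
      ⟨_, isCommutator_rankOne hH.selfAdjoint (hd q.1) (hε q.1) (hd q.2) (hε q.2), rfl⟩
    refine ⟨c • (E, Complex.I • ((ε q.1 - ε q.2 : ℝ) : ℂ) • E),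
      (heisenbergGraph H).smul_mem c h1, ?_⟩
    simp only [Prod.smul_mk, LinearMap.prodMap_apply, map_smul, smul_smul]
    congr 2
    ring
  · rw [heisenbergGen_graph] at hxy
    obtain ⟨⟨A, A'⟩, ⟨C, hC, hA'⟩, h⟩ := hxy
    simp only [LinearMap.prodMap_apply, Prod.mk.injEq] at h hA' hC
    rw [← h.1, ← h.2, hA', hb, map_smul, inner_smul_left, inner_smul_left, inner_smul_right,
      hH.gibbs.inner_toObs_rankOne f hρ, hH.gibbs.inner_toObs_rankOne f hρ,
      hC.inner_apply hH.selfAdjoint (hd q.1) (hε q.1) (hd q.2) (hε q.2)]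
    ring

end Heisenberg

end OpenQuantum

open OpenQuantum in
theorem mainTheorem8 {ℋ : Type*} [NormedAddCommGroup ℋ] [InnerProductSpace ℂ ℋ] [CompleteSpace ℋ]
    [Nontrivial ℋ] (H : ℋ →ₗ.[ℂ] ℋ) (τ : ℝ) (hH : ConditionH H τ)
    (W : ℕ → ℋ →L[ℂ] ℋ) (hW : ConditionW W) (hQDB : QDB W hH.gibbs) :
    (∃ G' : hH.gibbs.ObsSpace →L[ℂ] hH.gibbs.ObsSpace,
      (∀ A : ℋ →L[ℂ] ℋ, G' (hH.gibbs.toObs A) = hH.gibbs.toObs (lindbladDual W A)) ∧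
      IsSelfAdjoint G' ∧
      G' ≤ 0 ∧
      Module.End.HasEigenvalue (G' : hH.gibbs.ObsSpace →ₗ[ℂ] hH.gibbs.ObsSpace) 0) ∧
    (Dense ((heisenbergGen hH).domain : Set hH.gibbs.ObsSpace) ∧
      (heisenbergGen hH).IsClosable ∧
      (heisenbergGen hH).closure† = -(heisenbergGen hH).closure) ∧
    (∀ A : ℋ →L[ℂ] ℋ,
      HasSum (fun j => -(1 / 2 : ℂ) *
          trace (star (W j * A - A * W j) * (W j * A - A * W j) * hH.gibbs.op))
        ⟪hH.gibbs.toObs A, hH.gibbs.toObs (lindbladDual W A)⟫_ℂ) := by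
  have hc := hW.colBounded
  obtain ⟨G', hG, hsa, hneg⟩ := hQDB.exists_extension hc
  refine ⟨⟨G', hG, hsa, hneg, ?_⟩, heisenbergGen_closure_adjoint hH, hQDB.hasSum_commutator hc⟩
  refine Module.End.hasEigenvalue_of_hasEigenvector (x := hH.gibbs.toObs 1)
    ⟨Module.End.mem_eigenspace_iff.2 ?_, fun h => ?_⟩
  · change G' (hH.gibbs.toObs 1) = _
    rw [hG, lindbladDual_one, map_zero, zero_smul]
  · exact one_ne_zero (hH.toObs_injective (h.trans (map_zero _).symm))
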